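/- Let $\Bbbk$ be an algebraically closed field of characteristic zero. Let $\theta\in\mathbb{N}$, let $G$ be a finite abelian group, and let $g_1,\dots,g_\theta\in G$ and characters $\chi_1,\dots,\chi_\theta\in\operatorname{Hom}(G,\Bbbk^\times)$ satisfy $\chi_i(g_j)=\chi_j(g_i)^{-1}$ for $i\neq j$ and $m_i:=\operatorname{ord}(\chi_i(g_i))\geq 2$. Let $B=B(G,\underline g,\underline\chi)$ be the bosonization (of rank $\theta$) of the corresponding quantum linear space, i.e. the Hopf algebra over $\Bbbk$ generated by $G$ and $x_1,\dots,x_\theta$ with the relations of $G$ and $$x_i^{m_i}=0,\qquad x_ix_j=\chi_j(g_i)\,x_jx_i\ (i\neq j),\qquad hx_i=\chi_i(h)\,x_ih\ (h\in G),$$ where the elements of $G$ are grouplike and $\Delta(x_i)=g_i\otimes x_i+x_i\otimes 1$. Let $t\geq 2$, and let $\mathbf p=(p_{ij})\in M_t(\Bbbk^\times)$ be multiplicatively antisymmetric ($p_{ii}=1$, $p_{ij}=p_{ji}^{-1}$). Let $A=\Bbbk_{\mathbf p}[u_1,\dots,u_t]$ be the quantum affine space, i.e. the algebra generated by $u_1,\dots,u_t$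 with relations $u_iu_j=p_{ij}u_ju_i$. An action of $B$ on $A$ (a left $B$-module algebra structure) is called linear if each $g_i$ and each $x_i$ maps $\operatorname{span}_\Bbbk\{u_1,\dots,u_t\}$ to itself, and inner faithful if no nonzero Hopf ideal of $B$ annihilates $A$. Assume that for all $i\neq j$ the order of $p_{ij}$ in $\Bbbk^\times$ is at least $3$ (infinite order being allowed). (1) If some $B=B(G,\underline g,\underline\chi)$ of rank $\theta$ with $m_i\geq 3$ for all $i$ acts linearly and inner faithfully on $A$, then $\theta\leq 2(t-1)$. (2) The bound is sharp: if moreover every $p_{ij}$ is a root of unity, then there is a $B=B(G,\underline g,\underline\chi)$ of rank exactly $2(t-1)$, with $m_i\geq 3$ for all $i$, that acts linearly and inner faithfully on $A$. -/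

import Mathlib

open scoped TensorProduct

universe u v w

/-! ### A vanishing case of the `q`-binomial theorem -/

/-- The coefficient of `a ^ i * b ^ j` in `(a + b) ^ (i + j)` when `b * a = q • (a * b)`. -/
def qBinomCoeff {k : Type u} [Field k] (q : k) : ℕ → ℕ → k
  | 0, _ => 1
  | _ + 1, 0 => 1
  | i + 1, j + 1 => q ^ (j + 1) * qBinomCoeff q i (j + 1) + qBinomCoeff q (i + 1) j

theorem qBinomCoeff_zero_right {k : Type u} [Field k] (q : k) (i : ℕ) :
    qBinomCoeff q i 0 = 1 := by
  cases i <;> simp [qBinomCoeff]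

theorem qBinomCoeff_zero_left {k : Type u} [Field k] (q : k) (j : ℕ) :
    qBinomCoeff q 0 j = 1 := by
  simp [qBinomCoeff]

theorem qBinomCoeff_rec {k : Type u} [Field k] (q : k) (n : ℕ) :
    ∀ i j : ℕ, i + j = n →
      (q ^ (i + 1) - 1) * qBinomCoeff q (i + 1) j = (q ^ (i + j + 1) - 1) * qBinomCoeff q i j ∧
      (q ^ (j + 1) - 1) * qBinomCoeff q i (j + 1) = (q ^ (i + j + 1) - 1) * qBinomCoeff q i j := by
  induction n with
  | zero =>
    intro i j h
    obtain ⟨rfl, rfl⟩ : i = 0 ∧ j = 0 := by omega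
    simp [qBinomCoeff]
  | succ n ih =>
    intro i j h
    constructor
    · cases j with
      | zero => simp [qBinomCoeff_zero_right]
      | succ j =>
        obtain ⟨h1, h2⟩ := ih i j (by omega)
        have e : qBinomCoeff q (i + 1) (j + 1)
            = q ^ (j + 1) * qBinomCoeff q i (j + 1) + qBinomCoeff q (i + 1) j := by
          simp [qBinomCoeff]
        rw [e]
        linear_combination h1 - h2
    · cases i with
      | zero => simp [qBinomCoeff_zero_left]
      | succ i =>
        obtain ⟨h1, h2⟩ := ih i j (by omega)
        have e : qBinomCoeff q (i + 1) (j + 1)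
            = q ^ (j + 1) * qBinomCoeff q i (j + 1) + qBinomCoeff q (i + 1) j := by
          simp [qBinomCoeff]
        rw [e]
        linear_combination q ^ (j + 1) * h2 - q ^ (j + 1) * h1

theorem qCommute_pow {k : Type u} [Field k] {R : Type v} [Ring R] [Algebra k R]
    {q : k} {a b : R} (h : b * a = q • (a * b)) (n : ℕ) :
    b ^ n * a = q ^ n • (a * b ^ n) := by
  induction n with
  | zero => simp
  | succ n ih =>
    rw [pow_succ, mul_assoc, h, mul_smul_comm, ← mul_assoc, ih, smul_mul_assoc, smul_smul,
      mul_assoc]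
    congr 1
    ring

theorem qBinomial {k : Type u} [Field k] {R : Type v} [Ring R] [Algebra k R]
    {q : k} {a b : R} (h : b * a = q • (a * b)) (n : ℕ) :
    (a + b) ^ n =
      ∑ ij ∈ Finset.HasAntidiagonal.antidiagonal n, qBinomCoeff q ij.1 ij.2 • (a ^ ij.1 * b ^ ij.2) := by
  induction n with
  | zero => simp [qBinomCoeff]
  | succ n ih =>
    have hA : ∀ i j : ℕ, qBinomCoeff q i j • (a ^ i * b ^ j) * a
        = (q ^ j * qBinomCoeff q i j) • (a ^ (i + 1) * b ^ j) := by
      intro i j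
      rw [smul_mul_assoc, mul_assoc, qCommute_pow h, mul_smul_comm, smul_smul, ← mul_assoc,
        ← pow_succ, mul_comm]
    have hB : ∀ i j : ℕ, qBinomCoeff q i j • (a ^ i * b ^ j) * b
        = qBinomCoeff q i j • (a ^ i * b ^ (j + 1)) := by
      intro i j
      rw [smul_mul_assoc, mul_assoc, ← pow_succ]
    rw [pow_succ, ih, mul_add, Finset.sum_mul, Finset.sum_mul]
    simp only [hA, hB]
    cases n with
    | zero => simp [Finset.Nat.antidiagonal_succ, qBinomCoeff, add_comm]
    | succ n =>
      rw [Finset.Nat.sum_antidiagonal_succ'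
        (f := fun ij : ℕ × ℕ => (q ^ ij.2 * qBinomCoeff q ij.1 ij.2) • (a ^ (ij.1 + 1) * b ^ ij.2)),
        Finset.Nat.sum_antidiagonal_succ
        (f := fun ij : ℕ × ℕ => qBinomCoeff q ij.1 ij.2 • (a ^ ij.1 * b ^ (ij.2 + 1))),
        Finset.Nat.sum_antidiagonal_succ
        (f := fun ij : ℕ × ℕ => qBinomCoeff q ij.1 ij.2 • (a ^ ij.1 * b ^ ij.2)),
        Finset.Nat.sum_antidiagonal_succ'
        (f := fun ij : ℕ × ℕ => qBinomCoeff q (ij.1 + 1) ij.2 • (a ^ (ij.1 + 1) * b ^ ij.2))]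
      simp only [qBinomCoeff, qBinomCoeff_zero_right, add_smul, Finset.sum_add_distrib]
      simp only [pow_zero, one_mul, mul_one]
      abel

/-- If `b * a = q • (a * b)` with `q` of order `m ≥ 1`, then `(a + b) ^ m = a ^ m + b ^ m`. -/
theorem add_pow_of_qCommute {k : Type u} [Field k] {R : Type v} [Ring R] [Algebra k R]
    {q : k} {a b : R} {m : ℕ} (hm : 1 ≤ m) (h : b * a = q • (a * b)) (hq : IsPrimitiveRoot q m) :
    (a + b) ^ m = a ^ m + b ^ m := by
  obtain ⟨m, rfl⟩ : ∃ m', m = m' + 1 := ⟨m - 1, by omega⟩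
  rw [qBinomial h]
  have key : ∀ i j : ℕ, i + j = m → 1 ≤ j → qBinomCoeff q (i + 1) j = 0 := by
    intro i j hij hj
    have h1 := (qBinomCoeff_rec q _ i j rfl).1
    rw [hij, hq.pow_eq_one, sub_self, zero_mul] at h1
    rcases mul_eq_zero.1 h1 with h2 | h2
    · exact absurd (sub_eq_zero.1 h2) (hq.pow_ne_one_of_pos_of_lt (by omega) (by omega))
    · exact h2
  rw [Finset.Nat.sum_antidiagonal_succ]
  rw [Finset.sum_eq_single (m, 0)]
  · simp [qBinomCoeff, add_comm]
  · rintro ⟨i, j⟩ hij hne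
    have hij' : i + j = m := by simpa using hij
    have hj : 1 ≤ j := by
      rcases Nat.eq_zero_or_pos j with rfl | hj
      · exact absurd (by simp at hij'; simp [hij']) hne
      · exact hj
    simp [key i j hij' hj]
  · simp

/-! ### Bosonizations of quantum linear spaces -/

/-- The data `(G, g₁, …, g_θ, χ₁, …, χ_θ)` defining a quantum linear space of rank `θ` over the
(finite abelian) group `G`. -/
structure QLSDatum (k : Type u) [Field k] (G : Type v) [CommGroup G] (θ : ℕ) where
  /-- the group elements `gᵢ` -/
  g : Fin θ → G
  /-- the characters `χᵢ` -/
  χ : Fin θ → (G →* kˣ)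
  compat : ∀ i j, i ≠ j → χ i (g j) = (χ j (g i))⁻¹
  two_le_order : ∀ i, 2 ≤ orderOf (χ i (g i))

namespace QLSDatum

variable {k : Type u} [Field k] {G : Type v} [CommGroup G] {θ : ℕ}

/-- `mᵢ`, the order of `χᵢ(gᵢ)`. -/
noncomputable def m (D : QLSDatum k G θ) (i : Fin θ) : ℕ := orderOf (D.χ i (D.g i))

/-- The generator of the free algebra attached to a group element. -/
def freeGrp (_D : QLSDatum k G θ) (h : G) : FreeAlgebra k (G ⊕ Fin θ) :=
  FreeAlgebra.ι k (Sum.inl h)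

/-- The generator of the free algebra attached to an index `i`. -/
def freeX (_D : QLSDatum k G θ) (i : Fin θ) : FreeAlgebra k (G ⊕ Fin θ) :=
  FreeAlgebra.ι k (Sum.inr i)

/-- The defining relations of the bosonization. -/
inductive Rel (D : QLSDatum k G θ) :
    FreeAlgebra k (G ⊕ Fin θ) → FreeAlgebra k (G ⊕ Fin θ) → Prop
  | one : Rel D (D.freeGrp 1) 1
  | mul (h h' : G) : Rel D (D.freeGrp (h * h')) (D.freeGrp h * D.freeGrp h')
  | grp_x (h : G) (i : Fin θ) :
      Rel D (D.freeGrp h * D.freeX i) ((D.χ i h : k) • (D.freeX i * D.freeGrp h))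
  | x_pow (i : Fin θ) : Rel D (D.freeX i ^ D.m i) 0
  | x_x (i j : Fin θ) (hij : i ≠ j) :
      Rel D (D.freeX i * D.freeX j) ((D.χ j (D.g i) : k) • (D.freeX j * D.freeX i))

/-- The algebra `B(G, g, χ)`: the bosonization of the quantum linear space of the datum,
generated by the group `G` and by `x₁, …, x_θ`. -/
def Bosonization (D : QLSDatum k G θ) : Type (max u v) := RingQuot D.Rel

noncomputable instance (D : QLSDatum k G θ) : Ring D.Bosonization :=
  inferInstanceAs (Ring (RingQuot D.Rel))

noncomputable instance (D : QLSDatum k G θ) : Algebra k D.Bosonization :=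
  inferInstanceAs (Algebra k (RingQuot D.Rel))

/-- The quotient map from the free algebra. -/
noncomputable def proj (D : QLSDatum k G θ) : FreeAlgebra k (G ⊕ Fin θ) →ₐ[k] D.Bosonization :=
  RingQuot.mkAlgHom k D.Rel

/-- A group element, viewed in the bosonization. -/
noncomputable def grp (D : QLSDatum k G θ) (h : G) : D.Bosonization := D.proj (D.freeGrp h)

/-- The generator `xᵢ` of the bosonization. -/
noncomputable def x (D : QLSDatum k G θ) (i : Fin θ) : D.Bosonization := D.proj (D.freeX i)

variable (D : QLSDatum k G θ)

theorem proj_surjective : Function.Surjective D.proj := RingQuot.mkAlgHom_surjective k D.Rel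

theorem proj_rel {a b : FreeAlgebra k (G ⊕ Fin θ)} (h : D.Rel a b) : D.proj a = D.proj b :=
  RingQuot.mkAlgHom_rel k h

theorem grp_one : D.grp 1 = 1 := by
  simpa [grp] using D.proj_rel Rel.one

theorem grp_mul (h h' : G) : D.grp (h * h') = D.grp h * D.grp h' := by
  simpa [grp] using D.proj_rel (Rel.mul h h')

theorem grp_mul_x (h : G) (i : Fin θ) :
    D.grp h * D.x i = (D.χ i h : k) • (D.x i * D.grp h) := by
  simpa [grp, x] using D.proj_rel (Rel.grp_x h i)

theorem x_pow_m (i : Fin θ) : D.x i ^ D.m i = 0 := by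
  simpa [x] using D.proj_rel (Rel.x_pow i)

theorem x_mul_x {i j : Fin θ} (hij : i ≠ j) :
    D.x i * D.x j = (D.χ j (D.g i) : k) • (D.x j * D.x i) := by
  simpa [x] using D.proj_rel (Rel.x_x i j hij)

theorem m_pos (i : Fin θ) : 1 ≤ D.m i := le_trans (by norm_num) (D.two_le_order i)

/-- The universal property of the presentation. -/
noncomputable def lift {C : Type w} [Ring C] [Algebra k C] (f : G → C) (y : Fin θ → C)
    (h1 : f 1 = 1) (h2 : ∀ h h', f (h * h') = f h * f h')
    (h3 : ∀ h i, f h * y i = (D.χ i h : k) • (y i * f h))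
    (h4 : ∀ i, y i ^ D.m i = 0)
    (h5 : ∀ i j, i ≠ j → y i * y j = (D.χ j (D.g i) : k) • (y j * y i)) :
    D.Bosonization →ₐ[k] C :=
  RingQuot.liftAlgHom k ⟨FreeAlgebra.lift k (Sum.elim f y), by
    intro a b hab
    induction hab with
    | one => simpa [freeGrp] using h1
    | mul h h' => simpa [freeGrp] using h2 h h'
    | grp_x h i => simpa [freeGrp, freeX] using h3 h i
    | x_pow i => simpa [freeX] using h4 i
    | x_x i j hij => simpa [freeX] using h5 i j hij⟩

section lift

variable {C : Type w} [Ring C] [Algebra k C] (f : G → C) (y : Fin θ → C)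
    (h1 : f 1 = 1) (h2 : ∀ h h', f (h * h') = f h * f h')
    (h3 : ∀ h i, f h * y i = (D.χ i h : k) • (y i * f h))
    (h4 : ∀ i, y i ^ D.m i = 0)
    (h5 : ∀ i j, i ≠ j → y i * y j = (D.χ j (D.g i) : k) • (y j * y i))

theorem lift_proj (a : FreeAlgebra k (G ⊕ Fin θ)) :
    D.lift f y h1 h2 h3 h4 h5 (D.proj a) = FreeAlgebra.lift k (Sum.elim f y) a :=
  RingQuot.liftAlgHom_mkAlgHom_apply k _ _ a

@[simp]
theorem lift_grp (h : G) : D.lift f y h1 h2 h3 h4 h5 (D.grp h) = f h := by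
  simp [grp, lift_proj, freeGrp]

@[simp]
theorem lift_x (i : Fin θ) : D.lift f y h1 h2 h3 h4 h5 (D.x i) = y i := by
  simp [x, lift_proj, freeX]

end lift

theorem induction {P : D.Bosonization → Prop} (hs : ∀ r : k, P (algebraMap k _ r))
    (hg : ∀ h, P (D.grp h)) (hx : ∀ i, P (D.x i)) (hm : ∀ a b, P a → P b → P (a * b))
    (ha : ∀ a b, P a → P b → P (a + b)) (a : D.Bosonization) : P a := by
  obtain ⟨a, rfl⟩ := D.proj_surjective a
  induction a using FreeAlgebra.induction with
  | grade0 r => simpa using hs r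
  | grade1 s =>
    rcases s with h | i
    · exact hg h
    · exact hx i
  | mul a b h1 h2 => simpa using hm _ _ h1 h2
  | add a b h1 h2 => simpa using ha _ _ h1 h2

theorem hom_ext {C : Type w} [Ring C] [Algebra k C] {f f' : D.Bosonization →ₐ[k] C}
    (hg : ∀ h, f (D.grp h) = f' (D.grp h)) (hx : ∀ i, f (D.x i) = f' (D.x i)) : f = f' := by
  ext a
  induction a using D.induction with
  | hs r => simp
  | hg h => exact hg h
  | hx i => exact hx i
  | hm a b h1 h2 => simp [h1, h2]
  | ha a b h1 h2 => simp [h1, h2]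

/-- The value `gᵢ ⊗ xᵢ + xᵢ ⊗ 1` of the comultiplication at `xᵢ`. -/
noncomputable def dx (i : Fin θ) : D.Bosonization ⊗[k] D.Bosonization :=
  D.x i ⊗ₜ 1 + D.grp (D.g i) ⊗ₜ D.x i

/-- The value `h ⊗ h` of the comultiplication at `h ∈ G`. -/
noncomputable def dgrp (h : G) : D.Bosonization ⊗[k] D.Bosonization :=
  D.grp h ⊗ₜ D.grp h

theorem dgrp_one : D.dgrp 1 = 1 := by
  simp [dgrp, grp_one, Algebra.TensorProduct.one_def]

theorem dgrp_mul (h h' : G) : D.dgrp (h * h') = D.dgrp h * D.dgrp h' := by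
  simp [dgrp, grp_mul]

theorem dgrp_dx (h : G) (i : Fin θ) :
    D.dgrp h * D.dx i = (D.χ i h : k) • (D.dx i * D.dgrp h) := by
  simp only [dgrp, dx, mul_add, add_mul, Algebra.TensorProduct.tmul_mul_tmul, grp_mul_x, smul_add,
    mul_one, one_mul, TensorProduct.smul_tmul', TensorProduct.tmul_smul]
  rw [← grp_mul, ← grp_mul, mul_comm h]

theorem dx_pow (i : Fin θ) : D.dx i ^ D.m i = 0 := by
  unfold dx
  rw [add_pow_of_qCommute (q := (D.χ i (D.g i) : k)) (m := D.m i) (D.m_pos i)]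
  · simp [Algebra.TensorProduct.tmul_pow, x_pow_m]
  · simp [grp_mul_x, TensorProduct.smul_tmul']
  · exact (IsPrimitiveRoot.orderOf (D.χ i (D.g i))).map_of_injective
      (f := Units.coeHom k) Units.val_injective

theorem dx_dx (i j : Fin θ) (hij : i ≠ j) :
    D.dx i * D.dx j = (D.χ j (D.g i) : k) • (D.dx j * D.dx i) := by
  have hc : (D.χ j (D.g i) : k) * (D.χ i (D.g j) : k) = 1 := by
    rw [D.compat i j hij]; simp
  simp only [dx, mul_add, add_mul, Algebra.TensorProduct.tmul_mul_tmul, grp_mul_x, smul_add,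
    mul_one, one_mul, TensorProduct.smul_tmul', TensorProduct.tmul_smul, D.x_mul_x hij,
    smul_smul, hc, one_smul]
  rw [← grp_mul, ← grp_mul, mul_comm (D.g i)]
  abel

/-- The comultiplication: `Δ(h) = h ⊗ h` for `h ∈ G` and `Δ(xᵢ) = gᵢ ⊗ xᵢ + xᵢ ⊗ 1`. -/
noncomputable def comulHom : D.Bosonization →ₐ[k] D.Bosonization ⊗[k] D.Bosonization :=
  D.lift D.dgrp D.dx D.dgrp_one D.dgrp_mul D.dgrp_dx D.dx_pow D.dx_dx

/-- The counit: `ε(h) = 1` for `h ∈ G` and `ε(xᵢ) = 0`. -/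
noncomputable def counitHom : D.Bosonization →ₐ[k] k :=
  D.lift (fun _ => 1) (fun _ => 0) rfl (by simp) (by simp)
    (fun i => zero_pow (by have := D.m_pos i; omega)) (by simp)

theorem grp_inv_mul (h : G) : D.grp h⁻¹ * D.grp h = 1 := by
  rw [← grp_mul, inv_mul_cancel, grp_one]

theorem grp_mul_inv (h : G) : D.grp h * D.grp h⁻¹ = 1 := by
  rw [← grp_mul, mul_inv_cancel, grp_one]

theorem x_mul_grp (h : G) (i : Fin θ) :
    D.x i * D.grp h = (D.χ i h⁻¹ : k) • (D.grp h * D.x i) := by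
  rw [grp_mul_x, smul_smul, map_inv, Units.inv_mul, one_smul]

theorem grp_x_pow (h : G) (i : Fin θ) (n : ℕ) :
    ∃ c : k, (D.grp h * D.x i) ^ n = c • (D.grp h ^ n * D.x i ^ n) := by
  induction n with
  | zero => exact ⟨1, by simp⟩
  | succ n ih =>
    obtain ⟨c, hc⟩ := ih
    have h1 := qCommute_pow (D.x_mul_grp h i) n
    refine ⟨c * (D.χ i h⁻¹ : k) ^ n, ?_⟩
    rw [pow_succ, hc, smul_mul_assoc, mul_assoc (D.grp h ^ n), ← mul_assoc (D.x i ^ n), h1,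
      smul_mul_assoc, mul_smul_comm, smul_smul, pow_succ (D.grp h), pow_succ (D.x i)]
    simp only [mul_assoc]

/-- The antipode, as a map to the opposite algebra: `S(h) = h⁻¹` for `h ∈ G` and
`S(xᵢ) = -gᵢ⁻¹xᵢ`. -/
noncomputable def antipodeHom : D.Bosonization →ₐ[k] (D.Bosonization)ᵐᵒᵖ :=
  D.lift (fun h => MulOpposite.op (D.grp h⁻¹))
    (fun i => MulOpposite.op (-(D.grp (D.g i)⁻¹ * D.x i)))
    (by simp [grp_one])
    (fun h h' => by
      rw [← MulOpposite.op_mul, ← grp_mul, mul_inv_rev])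
    (fun h i => by
      rw [← MulOpposite.op_mul, ← MulOpposite.op_mul, ← MulOpposite.op_smul]
      congr 1
      rw [mul_neg, neg_mul, smul_neg, mul_assoc, x_mul_grp, inv_inv, mul_smul_comm, ← mul_assoc,
        ← mul_assoc, ← grp_mul, ← grp_mul, mul_comm h⁻¹])
    (fun i => by
      obtain ⟨c, hc⟩ := D.grp_x_pow (D.g i)⁻¹ i (D.m i)
      rw [← MulOpposite.op_pow, neg_pow, hc, x_pow_m]
      simp)
    (fun i j hij => by
      rw [← MulOpposite.op_mul, ← MulOpposite.op_mul, ← MulOpposite.op_smul]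
      congr 1
      have e : ∀ a b : Fin θ, D.grp (D.g a)⁻¹ * D.x a * (D.grp (D.g b)⁻¹ * D.x b)
          = (D.χ a (D.g b) : k) • (D.grp ((D.g a)⁻¹ * (D.g b)⁻¹) * (D.x a * D.x b)) := by
        intro a b
        rw [mul_assoc, ← mul_assoc (D.x a), x_mul_grp, inv_inv, smul_mul_assoc, mul_smul_comm,
          grp_mul]
        simp only [mul_assoc]
      have hc : (D.χ j (D.g i) : k) * (D.χ i (D.g j) : k) = 1 := by
        rw [D.compat i j hij]; simp
      rw [neg_mul_neg, neg_mul_neg, e, e, D.x_mul_x hij, mul_smul_comm, smul_smul, hc, one_smul,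
        D.x_mul_x hij.symm, mul_comm (D.g j)⁻¹])

@[simp]
theorem comulHom_grp (h : G) : D.comulHom (D.grp h) = D.grp h ⊗ₜ D.grp h := by
  exact D.lift_grp _ _ D.dgrp_one D.dgrp_mul D.dgrp_dx D.dx_pow D.dx_dx h

@[simp]
theorem comulHom_x (i : Fin θ) :
    D.comulHom (D.x i) = D.x i ⊗ₜ 1 + D.grp (D.g i) ⊗ₜ D.x i := by
  exact D.lift_x _ _ D.dgrp_one D.dgrp_mul D.dgrp_dx D.dx_pow D.dx_dx i

@[simp]
theorem counitHom_grp (h : G) : D.counitHom (D.grp h) = 1 := by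
  simp [counitHom]

@[simp]
theorem counitHom_x (i : Fin θ) : D.counitHom (D.x i) = 0 := by
  simp [counitHom]

@[simp]
theorem antipodeHom_grp (h : G) : D.antipodeHom (D.grp h) = MulOpposite.op (D.grp h⁻¹) := by
  simp [antipodeHom]

@[simp]
theorem antipodeHom_x (i : Fin θ) :
    D.antipodeHom (D.x i) = MulOpposite.op (-(D.grp (D.g i)⁻¹ * D.x i)) := by
  simp [antipodeHom]

noncomputable instance : Bialgebra k D.Bosonization :=
  Bialgebra.ofAlgHom D.comulHom D.counitHom
    (by
      apply D.hom_ext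
      · intro h; simp
      · intro i
        simp [TensorProduct.add_tmul, TensorProduct.tmul_add, Algebra.TensorProduct.one_def,
          add_assoc])
    (by
      apply D.hom_ext
      · intro h; simp
      · intro i; simp)
    (by
      apply D.hom_ext
      · intro h; simp
      · intro i; simp)

theorem comul_eq (a : D.Bosonization) : Coalgebra.comul (R := k) a = D.comulHom a := rfl

theorem counit_eq (a : D.Bosonization) : Coalgebra.counit (R := k) a = D.counitHom a := rfl

/-- The antipode as a linear map. -/
noncomputable def antipodeLin : D.Bosonization →ₗ[k] D.Bosonization :=
  (MulOpposite.opLinearEquiv k).symm.toLinearMap ∘ₗ D.antipodeHom.toLinearMap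

theorem antipodeLin_apply (a : D.Bosonization) :
    D.antipodeLin a = MulOpposite.unop (D.antipodeHom a) := rfl

theorem antipodeLin_mul (a b : D.Bosonization) :
    D.antipodeLin (a * b) = D.antipodeLin b * D.antipodeLin a := by
  simp [antipodeLin_apply]

theorem antipodeLin_algebraMap (r : k) :
    D.antipodeLin (algebraMap k _ r) = algebraMap k _ r := by
  simp [antipodeLin_apply]

theorem antipodeLin_grp (h : G) : D.antipodeLin (D.grp h) = D.grp h⁻¹ := by
  simp [antipodeLin_apply]

theorem antipodeLin_x (i : Fin θ) : D.antipodeLin (D.x i) = -(D.grp (D.g i)⁻¹ * D.x i) := by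
  simp [antipodeLin_apply]

theorem antipode_left (a : D.Bosonization) :
    LinearMap.mul' k _ (D.antipodeLin.rTensor _ (D.comulHom a)) =
      algebraMap k _ (D.counitHom a) := by
  induction a using D.induction with
  | hs r => simp [Algebra.TensorProduct.algebraMap_apply, antipodeLin_algebraMap]
  | hg h => simp [antipodeLin_grp, grp_inv_mul]
  | hx i => simp [antipodeLin_grp, antipodeLin_x]
  | ha a b h1 h2 => simp only [map_add, h1, h2]
  | hm a b h1 h2 =>
    have key : ∀ u z : D.Bosonization ⊗[k] D.Bosonization, ∀ c : k,
        LinearMap.mul' k _ (D.antipodeLin.rTensor _ u) = algebraMap k _ c →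
        LinearMap.mul' k _ (D.antipodeLin.rTensor _ (u * z)) =
          c • LinearMap.mul' k _ (D.antipodeLin.rTensor _ z) := by
      intro u z c hu
      induction z using TensorProduct.induction_on with
      | zero => simp
      | add z1 z2 e1 e2 => simp only [mul_add, map_add, e1, e2, smul_add]
      | tmul p q =>
        have : ∀ u : D.Bosonization ⊗[k] D.Bosonization,
            LinearMap.mul' k _ (D.antipodeLin.rTensor _ (u * (p ⊗ₜ q))) =
              D.antipodeLin p * LinearMap.mul' k _ (D.antipodeLin.rTensor _ u) * q := by
          intro u
          induction u using TensorProduct.induction_on with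
          | zero => simp
          | add u1 u2 e1 e2 => simp only [add_mul, mul_add, map_add, e1, e2]
          | tmul r s => simp [antipodeLin_mul, mul_assoc]
        rw [this, hu, Algebra.algebraMap_eq_smul_one]
        simp
    rw [map_mul, key _ _ _ h1, h2, map_mul, map_mul, Algebra.smul_def]

theorem antipode_right (a : D.Bosonization) :
    LinearMap.mul' k _ (D.antipodeLin.lTensor _ (D.comulHom a)) =
      algebraMap k _ (D.counitHom a) := by
  induction a using D.induction with
  | hs r => simp [Algebra.TensorProduct.algebraMap_apply, antipodeLin_apply]
  | hg h => simp [antipodeLin_grp, grp_mul_inv]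
  | hx i =>
    have h1 : D.antipodeLin 1 = 1 := by simp [antipodeLin_apply]
    simp [antipodeLin_x, ← mul_assoc, grp_mul_inv, h1]
  | ha a b h1 h2 => simp only [map_add, h1, h2]
  | hm a b h1 h2 =>
    have key : ∀ u z : D.Bosonization ⊗[k] D.Bosonization, ∀ c : k,
        LinearMap.mul' k _ (D.antipodeLin.lTensor _ z) = algebraMap k _ c →
        LinearMap.mul' k _ (D.antipodeLin.lTensor _ (u * z)) =
          c • LinearMap.mul' k _ (D.antipodeLin.lTensor _ u) := by
      intro u z c hz
      induction u using TensorProduct.induction_on with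
      | zero => simp
      | add u1 u2 e1 e2 => simp only [add_mul, map_add, e1, e2, smul_add]
      | tmul p q =>
        have : ∀ z : D.Bosonization ⊗[k] D.Bosonization,
            LinearMap.mul' k _ (D.antipodeLin.lTensor _ ((p ⊗ₜ q) * z)) =
              p * LinearMap.mul' k _ (D.antipodeLin.lTensor _ z) * D.antipodeLin q := by
          intro z
          induction z using TensorProduct.induction_on with
          | zero => simp
          | add u1 u2 e1 e2 => simp only [add_mul, mul_add, map_add, e1, e2]
          | tmul r s => simp [antipodeLin_mul, mul_assoc]
        rw [this, hz, Algebra.algebraMap_eq_smul_one]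
        simp
    rw [map_mul, key _ _ _ h2, h1, map_mul, map_mul, Algebra.smul_def, Algebra.commutes]

/-- The Hopf algebra structure of the bosonization. -/
noncomputable instance : HopfAlgebra k D.Bosonization where
  antipode := D.antipodeLin
  mul_antipode_rTensor_comul := LinearMap.ext D.antipode_left
  mul_antipode_lTensor_comul := LinearMap.ext D.antipode_right

end QLSDatum

/-! ### Quantum affine spaces -/

/-- Multiplicatively antisymmetric matrices of nonzero scalars. -/
def IsMultAntisymm {k : Type u} [Field k] {t : ℕ} (p : Fin t → Fin t → kˣ) : Prop :=
  (∀ i, p i i = 1) ∧ ∀ i j, p i j = (p j i)⁻¹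

/-- The defining relations `uᵢuⱼ = pᵢⱼuⱼuᵢ` of quantum affine space. -/
inductive QASRel {k : Type u} [Field k] {t : ℕ} (p : Fin t → Fin t → kˣ) :
    FreeAlgebra k (Fin t) → FreeAlgebra k (Fin t) → Prop
  | rel (i j : Fin t) : QASRel p (FreeAlgebra.ι k i * FreeAlgebra.ι k j)
      ((p i j : k) • (FreeAlgebra.ι k j * FreeAlgebra.ι k i))

/-- The quantum affine space `k_p[u₁, …, u_t]`. -/
def QuantumAffineSpace {k : Type u} [Field k] {t : ℕ} (p : Fin t → Fin t → kˣ) : Type u :=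
  RingQuot (QASRel p)

namespace QuantumAffineSpace

variable {k : Type u} [Field k] {t : ℕ} (p : Fin t → Fin t → kˣ)

noncomputable instance : Ring (QuantumAffineSpace p) :=
  inferInstanceAs (Ring (RingQuot (QASRel p)))

noncomputable instance : Algebra k (QuantumAffineSpace p) :=
  inferInstanceAs (Algebra k (RingQuot (QASRel p)))

/-- The generator `uᵢ`. -/
noncomputable def gen (i : Fin t) : QuantumAffineSpace p :=
  RingQuot.mkAlgHom k (QASRel p) (FreeAlgebra.ι k i)

/-- The degree one component, spanned by the generators. -/
noncomputable def degreeOne : Submodule k (QuantumAffineSpace p) :=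
  Submodule.span k (Set.range (gen p))

end QuantumAffineSpace

/-! ### Hopf actions -/

section HopfActions

variable {k : Type u} [Field k] {H : Type v} [Ring H] [HopfAlgebra k H] {A : Type w} [Ring A]
  [Algebra k A]

/-- A representation `ρ` of the Hopf algebra `H` on the algebra `A` makes `A` a left `H`-module
algebra: `h · 1 = ε(h)1` and `h · (aa') = ∑ (h₁ · a)(h₂ · a')`. -/
def IsHopfAction (ρ : H →ₐ[k] Module.End k A) : Prop :=
  (∀ h : H, ρ h 1 = algebraMap k A (Coalgebra.counit h)) ∧
  ∀ (h : H) (a a' : A), ρ h (a * a') =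
    LinearMap.mul' k A (TensorProduct.map₂ ρ.toLinearMap ρ.toLinearMap
      (Coalgebra.comul h) (a ⊗ₜ[k] a'))

/-- No nonzero (two-sided) Hopf ideal of `H` annihilates `A`. -/
def IsInnerFaithful (ρ : H →ₐ[k] Module.End k A) : Prop :=
  ∀ I : Ideal H, I.IsTwoSided → I.IsHopfIdeal k → (∀ h ∈ I, ∀ a : A, ρ h a = 0) → I = ⊥

end HopfActions

/-- The action of a bosonization on a quantum affine space is linear: each `gᵢ` and each `xᵢ` maps
the degree one component to itself. -/
def IsLinearAction {k : Type u} [Field k] {G : Type v} [CommGroup G] {θ t : ℕ}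
    (D : QLSDatum k G θ) (p : Fin t → Fin t → kˣ)
    (ρ : D.Bosonization →ₐ[k] Module.End k (QuantumAffineSpace p)) : Prop :=
  ∀ i : Fin θ, ∀ a ∈ QuantumAffineSpace.degreeOne p,
    ρ (D.grp (D.g i)) a ∈ QuantumAffineSpace.degreeOne p ∧
    ρ (D.x i) a ∈ QuantumAffineSpace.degreeOne p

/-! ### Quantum affine space and linear functionals on it in degrees one and two. -/

namespace QuantumAffineSpace

variable {k : Type u} [Field k] {t : ℕ} {p : Fin t → Fin t → kˣ}

/-! Upper bound. Each `g_i` acts as a graded automorphism and each `x_i` as a skew derivation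
twisted by `g_i`. Since `p_ab ≠ 1` for `a ≠ b`, `g_i` permutes the lines `k u_a`
(`exists_monomial`). If the permutation were nontrivial, comparing degree-two coefficients (with
`p_ab² ≠ 1`) would force `x_i` to kill all generators (`skewDerivation_eq_zero_of_moved`); then the
Hopf ideal `(x_i)` would annihilate `A`, against inner faithfulness. So `g_i` is diagonal, and one
nonzero entry of `x_i`, from `u_a` to `u_c`, determines all its eigenvalues
(`skewDerivation_diagonal`). Consequently every `x_i` sends each generator to a multiple of a
generator. The `x_i` are nilpotent and commute up to scalars, so they all kill some `u_z`; each
`x_i` has a source among the other `t - 1` generators. Two `x_i`, `x_j` with the same source satisfy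
`χ_i(g_i) χ_j(g_j) = 1`, and three would give `χ_j(g_j)² = 1`, which `m_j ≥ 3` excludes. Hence there
are at most two per source.

Sharpness. Fix the target `u_0` and attach to every other generator `u_a` two shifts `u_a ↦ u_0`,
with parameters `ζ` and `ζ⁻¹` for a primitive cube root of unity `ζ`. The eigenvalues of the `g_i`
are those dictated by the upper bound; they are roots of unity, so they lie in a finite diagonal
group. The relations of `B` reduce to generators, because a skew derivation is determined there. For
inner faithfulness (`eq_bot_of_stable`), a Hopf ideal annihilating `A` is stable under translation
by matrix coefficients of the action. Such translations separate the group elements and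
differentiate with respect to the `x_i`, which reduces any element of the ideal to a scalar, killed
by the counit. -/

theorem gen_mul_gen (i j : Fin t) :
    gen p i * gen p j = (p i j : k) • (gen p j * gen p i) := by
  have h := RingQuot.mkAlgHom_rel k (QASRel.rel (p := p) i j)
  rw [map_smul, map_mul, map_mul] at h
  exact h

theorem induction {P : QuantumAffineSpace p → Prop} (hs : ∀ r : k, P (algebraMap k _ r))
    (hg : ∀ i, P (gen p i)) (hm : ∀ a b, P a → P b → P (a * b))
    (ha : ∀ a b, P a → P b → P (a + b)) (a : QuantumAffineSpace p) : P a := by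
  obtain ⟨a, rfl⟩ := RingQuot.mkAlgHom_surjective k (QASRel p) a
  induction a using FreeAlgebra.induction with
  | grade0 r =>
    rw [AlgHom.commutes]
    exact hs r
  | grade1 s => exact hg s
  | mul a b h1 h2 => rw [map_mul]; exact hm _ _ h1 h2
  | add a b h1 h2 => rw [map_add]; exact ha _ _ h1 h2

/-- The universal property of quantum affine space. -/
noncomputable def lift {C : Type w} [Ring C] [Algebra k C] (v : Fin t → C)
    (hv : ∀ i j, v i * v j = (p i j : k) • (v j * v i)) : QuantumAffineSpace p →ₐ[k] C :=
  RingQuot.liftAlgHom k ⟨FreeAlgebra.lift k v, by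
    intro a b hab
    induction hab with
    | rel i j => simpa using hv i j⟩

@[simp]
theorem lift_gen {C : Type w} [Ring C] [Algebra k C] (v : Fin t → C)
    (hv : ∀ i j, v i * v j = (p i j : k) • (v j * v i)) (i : Fin t) :
    lift v hv (gen p i) = v i := by
  refine (RingQuot.liftAlgHom_mkAlgHom_apply k _ _ _).trans ?_
  simp

/-- Two skew derivations of the same type that agree on the generators are equal. -/
theorem skewDerivation_ext {φ ψ : QuantumAffineSpace p → QuantumAffineSpace p}
    (hφ : φ 1 = 1) (hψ : ψ 1 = 1) {δ δ' : Module.End k (QuantumAffineSpace p)}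
    (hδ : ∀ a b, δ (a * b) = φ a * δ b + δ a * ψ b)
    (hδ' : ∀ a b, δ' (a * b) = φ a * δ' b + δ' a * ψ b)
    (h : ∀ i, δ (gen p i) = δ' (gen p i)) : δ = δ' := by
  have h1 : δ 1 = 0 := by simpa [hφ, hψ] using hδ 1 1
  have h1' : δ' 1 = 0 := by simpa [hφ, hψ] using hδ' 1 1
  ext a
  induction a using induction with
  | hs r => rw [Algebra.algebraMap_eq_smul_one, map_smul, map_smul, h1, h1']
  | hg i => exact h i
  | hm a b ha hb => rw [hδ, hδ', ha, hb]
  | ha a b ha hb => rw [map_add, map_add, ha, hb]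

/-- The operator through which `u_a` acts in the representation attached to a matrix `M`. -/
def quadOp (M : Fin t → Fin t → k) (a : Fin t) : Module.End k (k × (Fin t → k) × k) where
  toFun y := (0, Pi.single a y.1, ∑ c, M a c * y.2.1 c)
  map_add' y z := by simp [Pi.single_add, mul_add, Finset.sum_add_distrib]
  map_smul' r y := by
    simp [Finset.mul_sum, mul_left_comm, ← Pi.single_smul]

/-- The representation of quantum affine space of Loewy length three attached to `M`. -/
noncomputable def quadRep (M : Fin t → Fin t → k) (hM : ∀ a b, M a b = p a b * M b a) :
    QuantumAffineSpace p →ₐ[k] Module.End k (k × (Fin t → k) × k) :=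
  lift (quadOp M) (fun a b => by
    ext <;> simp [quadOp, Pi.single_apply, hM a b])

/-- A functional on the component of degree two, with `u_a u_b ↦ M a b`. -/
noncomputable def quad (M : Fin t → Fin t → k) (hM : ∀ a b, M a b = p a b * M b a) :
    QuantumAffineSpace p →ₗ[k] k :=
  LinearMap.snd k _ _ ∘ₗ LinearMap.snd k _ _ ∘ₗ
    LinearMap.applyₗ ((1, 0, 0) : k × (Fin t → k) × k) ∘ₗ (quadRep M hM).toLinearMap

theorem quad_gen_mul_gen (M : Fin t → Fin t → k) (hM : ∀ a b, M a b = p a b * M b a)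
    (a b : Fin t) : quad M hM (gen p a * gen p b) = M a b := by
  simp [quad, quadRep, quadOp, Pi.single_apply]

variable (p) in
/-- The coefficient of `u_c`. -/
noncomputable def coeff (c : Fin t) : QuantumAffineSpace p →ₗ[k] k :=
  LinearMap.proj c ∘ₗ LinearMap.fst k _ _ ∘ₗ LinearMap.snd k _ _ ∘ₗ
    LinearMap.applyₗ ((1, 0, 0) : k × (Fin t → k) × k) ∘ₗ
      (quadRep (fun _ _ => 0) (by simp)).toLinearMap

theorem coeff_gen (c d : Fin t) : coeff p c (gen p d) = if d = c then 1 else 0 := by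
  simp [coeff, quadRep, quadOp, Pi.single_apply, eq_comm]

theorem coeff_gen_self (c : Fin t) : coeff p c (gen p c) = 1 := by
  simp [coeff_gen]

theorem coeff_sum_gen (c : Fin t) (f : Fin t → k) : coeff p c (∑ d, f d • gen p d) = f c := by
  simp [coeff_gen]

theorem gen_ne_zero (c : Fin t) : gen p c ≠ 0 := fun h => by
  simpa [h] using coeff_gen_self (p := p) c

theorem mem_degreeOne_iff {a : QuantumAffineSpace p} :
    a ∈ degreeOne p ↔ a = ∑ c, coeff p c a • gen p c := by
  constructor
  · intro ha
    obtain ⟨f, rfl⟩ := (Submodule.mem_span_range_iff_exists_fun k).1 ha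
    simp only [coeff_sum_gen]
  · intro ha
    rw [ha]
    exact Submodule.sum_mem _ fun c _ =>
      Submodule.smul_mem _ _ (Submodule.subset_span (Set.mem_range_self c))

theorem gen_mem_degreeOne (c : Fin t) : gen p c ∈ degreeOne p :=
  Submodule.subset_span (Set.mem_range_self c)

end QuantumAffineSpace

/-! ### Module algebra identities on the generators of the bosonization. -/

section HopfActionFormulas

variable {k : Type u} [Field k] {G : Type v} [CommGroup G] {θ : ℕ} {D : QLSDatum k G θ}
  {A : Type w} [Ring A] [Algebra k A] {ρ : D.Bosonization →ₐ[k] Module.End k A}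

theorem IsHopfAction.grp_mul (hρ : IsHopfAction ρ) (h : G) (a b : A) :
    ρ (D.grp h) (a * b) = ρ (D.grp h) a * ρ (D.grp h) b := by
  simp [hρ.2, QLSDatum.comul_eq]

theorem IsHopfAction.x_mul (hρ : IsHopfAction ρ) (i : Fin θ) (a b : A) :
    ρ (D.x i) (a * b) = ρ (D.x i) a * b + ρ (D.grp (D.g i)) a * ρ (D.x i) b := by
  simp [hρ.2, QLSDatum.comul_eq]

theorem IsHopfAction.x_one (hρ : IsHopfAction ρ) (i : Fin θ) : ρ (D.x i) 1 = 0 := by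
  simp [hρ.1, QLSDatum.counit_eq]

theorem rep_grp_inv_grp (ρ : D.Bosonization →ₐ[k] Module.End k A) (h : G) (a : A) :
    ρ (D.grp h⁻¹) (ρ (D.grp h) a) = a := by
  rw [← Module.End.mul_apply, ← map_mul, D.grp_inv_mul, map_one, Module.End.one_apply]

theorem rep_grp_x (ρ : D.Bosonization →ₐ[k] Module.End k A) (h : G) (i : Fin θ) (a : A) :
    ρ (D.grp h) (ρ (D.x i) a) = (D.χ i h : k) • ρ (D.x i) (ρ (D.grp h) a) := by
  rw [← Module.End.mul_apply, ← map_mul, D.grp_mul_x, map_smul, map_mul]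
  rfl

end HopfActionFormulas

/-! ### The Hopf ideal generated by one `x_i`. -/

namespace QLSDatum

variable {k : Type u} [Field k] {G : Type v} [CommGroup G] {θ : ℕ} (D : QLSDatum k G θ)

/-- A two-dimensional representation detects `x_i`: `h` acts by `diag(1, χ_i(h))`, `x_i` by a
square-zero matrix unit, and the other `x_j` by zero. The power relation holds because `m_i ≥ 2`. -/
theorem x_ne_zero (i : Fin θ) : D.x i ≠ 0 := by
  intro h0
  let E : Matrix (Fin 2) (Fin 2) k := !![0, 0; 1, 0]
  have hE : E * E = 0 := by ext a b; fin_cases a <;> fin_cases b <;> simp [E]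
  let φ : D.Bosonization →ₐ[k] Matrix (Fin 2) (Fin 2) k :=
    D.lift (fun h => !![1, 0; 0, (D.χ i h : k)]) (fun j => if j = i then E else 0)
      (by simp [Matrix.one_fin_two]) (by simp)
      (by
        intro h j
        by_cases hj : j = i
        · subst hj; simp [E]
        · simp [hj])
      (by
        intro j
        have hm : 2 ≤ D.m j := D.two_le_order j
        obtain ⟨n, hn⟩ := Nat.exists_eq_add_of_le hm
        by_cases hj : j = i
        · simp [hj ▸ hn, hj, pow_add, pow_two, hE]
        · simp [hj, hn])
      (by
        intro j l hjl
        by_cases hj : j = i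
        · have : l ≠ i := fun h => hjl (hj.trans h.symm)
          simp [this]
        · simp [hj])
  have h1 : φ (D.x i) = E := by simp [φ]
  rw [h0, map_zero] at h1
  simpa [E] using congrFun (congrFun h1 1) 0

theorem x_mul_mem_mul_x (i : Fin θ) (b : D.Bosonization) : ∃ b', D.x i * b = b' * D.x i := by
  induction b using D.induction with
  | hs r => exact ⟨algebraMap k _ r, (Algebra.commutes r (D.x i)).symm⟩
  | hg h => exact ⟨_, by rw [x_mul_grp, ← smul_mul_assoc]⟩
  | hx j =>
    by_cases hj : i = j
    · exact ⟨D.x i, by rw [hj]⟩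
    · exact ⟨_, by rw [D.x_mul_x hj, ← smul_mul_assoc]⟩
  | hm a b ha hb =>
    obtain ⟨a', ha⟩ := ha
    obtain ⟨b', hb⟩ := hb
    exact ⟨a' * b', by rw [← mul_assoc, ha, mul_assoc, hb, mul_assoc]⟩
  | ha a b ha hb =>
    obtain ⟨a', ha⟩ := ha
    obtain ⟨b', hb⟩ := hb
    exact ⟨a' + b', by rw [mul_add, add_mul, ha, hb]⟩

theorem isTwoSided_span_x (i : Fin θ) : (Ideal.span {D.x i}).IsTwoSided := by
  constructor
  intro a b ha
  obtain ⟨c, rfl⟩ := Ideal.mem_span_singleton'.1 ha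
  obtain ⟨b', hb⟩ := D.x_mul_mem_mul_x i b
  exact Ideal.mem_span_singleton'.2 ⟨c * b', by rw [mul_assoc, mul_assoc, hb]⟩

/-- Both terms of `Δ(x_i)` have `x_i` as a right factor in one leg, so each term of `Δ(c x_i)` has a
leg in the left ideal. The antipode reverses products, which is where two-sidedness enters. -/
theorem isHopfIdeal_span_x (i : Fin θ) : (Ideal.span {D.x i}).IsHopfIdeal k where
  counit_eq_zero := by
    intro a ha
    obtain ⟨c, rfl⟩ := Ideal.mem_span_singleton'.1 ha
    simp [counit_eq]
  map_mkQ_comul_eq_zero := by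
    intro a ha
    obtain ⟨c, rfl⟩ := Ideal.mem_span_singleton'.1 ha
    rw [comul_eq, map_mul, comulHom_x]
    have hx : ∀ b : D.Bosonization,
        (Submodule.restrictScalars k (Ideal.span {D.x i})).mkQ (b * D.x i) = 0 := fun b =>
      (Submodule.Quotient.mk_eq_zero _).2 (Ideal.mem_span_singleton'.2 ⟨b, rfl⟩)
    induction D.comulHom c using TensorProduct.induction_on with
    | zero => simp
    | add y z hy hz => rw [add_mul, map_add, hy, hz, add_zero]
    | tmul y z =>
      rw [mul_add, Algebra.TensorProduct.tmul_mul_tmul, Algebra.TensorProduct.tmul_mul_tmul,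
        map_add, TensorProduct.map_tmul, TensorProduct.map_tmul, hx, hx,
        TensorProduct.zero_tmul, TensorProduct.tmul_zero, add_zero]
  antipode_mem := by
    intro a ha
    obtain ⟨c, rfl⟩ := Ideal.mem_span_singleton'.1 ha
    have := D.isTwoSided_span_x i
    have e : HopfAlgebra.antipode k (c * D.x i) = D.antipodeLin (c * D.x i) := rfl
    rw [e, antipodeLin_mul, antipodeLin_x, ← neg_mul, mul_assoc]
    exact Ideal.mul_mem_left _ _ (Ideal.mul_mem_right _ _ (Ideal.subset_span rfl))

end QLSDatum

open QuantumAffineSpace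

/-- Under an inner faithful action no `x i` kills all the generators. -/
theorem IsInnerFaithful.exists_x_gen_ne_zero {k : Type u} [Field k] {G : Type v} [CommGroup G]
    {θ t : ℕ} {D : QLSDatum k G θ} {p : Fin t → Fin t → kˣ}
    {ρ : D.Bosonization →ₐ[k] Module.End k (QuantumAffineSpace p)} (hρ : IsHopfAction ρ)
    (hf : IsInnerFaithful ρ) (i : Fin θ) : ∃ a, ρ (D.x i) (gen p a) ≠ 0 := by
  by_contra! h
  have h0 : ρ (D.x i) = 0 := by
    ext a
    induction a using QuantumAffineSpace.induction with
    | hs r => rw [Algebra.algebraMap_eq_smul_one, map_smul, hρ.x_one]; simp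
    | hg a => exact h a
    | hm a b ha hb =>
      rw [hρ.x_mul, ha, hb]
      simp
    | ha a b ha hb => rw [map_add, map_add, ha, hb]
  have h1 := hf _ (D.isTwoSided_span_x i) (D.isHopfIdeal_span_x i) (by
    intro b hb a
    obtain ⟨c, rfl⟩ := Ideal.mem_span_singleton'.1 hb
    rw [map_mul, h0, mul_zero, LinearMap.zero_apply])
  exact D.x_ne_zero i (Ideal.span_singleton_eq_bot.1 h1)

/-! ### Graded automorphisms and linear skew derivations of quantum affine space. -/

section LinearMaps

variable {k : Type u} [Field k] {t : ℕ} {p : Fin t → Fin t → kˣ}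

/-- The symmetric tensor dual to `u_i u_j`. -/
def mixedCoeff (p : Fin t → Fin t → kˣ) (i j : Fin t) (e f : Fin t) : k :=
  (if e = i ∧ f = j then 1 else 0) + p e f * (if e = j ∧ f = i then 1 else 0)

theorem IsMultAntisymm.mul_swap (hp : IsMultAntisymm p) (a b : Fin t) :
    (p a b : k) * p b a = 1 := by
  rw [hp.2 a b, Units.inv_mul]

theorem IsMultAntisymm.self (hp : IsMultAntisymm p) (a : Fin t) : (p a a : k) = 1 := by
  rw [hp.1 a, Units.val_one]

theorem mixedCoeff_swap (hp : IsMultAntisymm p) (i j e f : Fin t) :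
    mixedCoeff p i j e f = p e f * mixedCoeff p i j f e := by
  unfold mixedCoeff
  rw [mul_add, ← mul_assoc, hp.mul_swap, one_mul, add_comm]
  simp only [and_comm]

/-- The tensor dual to `u_i ^ 2`. -/
def squareCoeff (i : Fin t) (e f : Fin t) : k := if e = i ∧ f = i then 1 else 0

theorem squareCoeff_swap (hp : IsMultAntisymm p) (i e f : Fin t) :
    (squareCoeff i e f : k) = p e f * squareCoeff i f e := by
  unfold squareCoeff
  by_cases he : e = i <;> by_cases hf : f = i <;> simp [he, hf, hp.self]

/-- A graded automorphism of a quantum affine space without commuting generators permutes the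
lines spanned by the generators. -/
theorem exists_monomial (hp : IsMultAntisymm p) (hne : ∀ a b, a ≠ b → (p a b : k) ≠ 1)
    {g : Module.End k (QuantumAffineSpace p)} (hg : ∀ a b, g (a * b) = g a * g b)
    (hinj : Function.Injective g) (hlin : ∀ a, g (gen p a) ∈ degreeOne p) :
    ∃ (σ : Fin t → Fin t) (α : Fin t → k), Function.Injective σ ∧ (∀ a, α a ≠ 0) ∧
      (∀ a, g (gen p a) = α a • gen p (σ a)) ∧
      ∀ a b, a ≠ b → (p (σ a) (σ b) : k) = p a b := by
  set c : Fin t → Fin t → k := fun a b => coeff p b (g (gen p a)) with hc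
  have hgc : ∀ a, g (gen p a) = ∑ b, c a b • gen p b := fun a => mem_degreeOne_iff.1 (hlin a)
  have hrel : ∀ a b, g (gen p a) * g (gen p b) = (p a b : k) • (g (gen p b) * g (gen p a)) := by
    intro a b
    rw [← hg, ← hg, gen_mul_gen, map_smul]
  -- The coefficient of `u_i²` in the relation gives `(1 - p_ab) c_ai c_bi = 0`: each column has at
  -- most one nonzero entry.
  have hcol : ∀ a b i, a ≠ b → c a i * c b i = 0 := by
    intro a b i hab
    have h := congrArg (quad (squareCoeff i) (squareCoeff_swap hp i)) (hrel a b)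
    simp only [hgc, Finset.sum_mul_sum, smul_mul_smul_comm, map_sum, map_smul, quad_gen_mul_gen,
      squareCoeff, smul_eq_mul] at h
    simp only [ite_and, mul_ite, mul_one, mul_zero, Finset.sum_ite_eq', Finset.sum_ite_irrel,
      Finset.sum_const_zero, Finset.mem_univ, if_true] at h
    have h2 : (1 - (p a b : k)) * (c a i * c b i) = 0 := by linear_combination h
    exact (mul_eq_zero.1 h2).resolve_left (sub_ne_zero.2 (hne a b hab).symm)
  have hrow : ∀ a, ∃ i, c a i ≠ 0 := by
    intro a
    by_contra! h
    have : g (gen p a) = 0 := by simp [hgc, h]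
    exact gen_ne_zero a (hinj (this.trans (map_zero g).symm))
  choose σ hσ using hrow
  have hσi : Function.Injective σ := by
    intro a b hab
    by_contra hne
    have := hcol a b (σ a) hne
    rw [hab] at this
    rcases mul_eq_zero.1 this with h | h
    · exact hσ a (hab ▸ h)
    · exact hσ b h
  have hmon : ∀ a, g (gen p a) = c a (σ a) • gen p (σ a) := by
    intro a
    rw [hgc, Finset.sum_eq_single (σ a)]
    · intro i _ hi
      obtain ⟨b, rfl⟩ := (Finite.injective_iff_surjective.1 hσi) i
      have hab : a ≠ b := fun h => hi (by rw [h])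
      rw [(mul_eq_zero.1 (hcol a b (σ b) hab)).resolve_right (hσ b), zero_smul]
    · simp
  refine ⟨σ, fun a => c a (σ a), hσi, hσ, hmon, ?_⟩
  intro a b hab
  have hab' : σ a ≠ σ b := fun h => hab (hσi h)
  -- The coefficient of `u_{σ a} u_{σ b}` shows that `σ` preserves the parameters.
  have h := congrArg (quad (mixedCoeff p (σ a) (σ b)) (mixedCoeff_swap hp _ _)) (hrel a b)
  simp only [hmon, smul_mul_smul_comm, map_smul, quad_gen_mul_gen, mixedCoeff, smul_eq_mul] at h
  simp only [and_self, if_true, hab', hab'.symm, if_false, mul_zero, add_zero, zero_add,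
    mul_one] at h
  have h2 : c a (σ a) * c b (σ b) * (1 - p a b * p (σ b) (σ a)) = 0 := by linear_combination h
  have h3 := (mul_eq_zero.1 h2).resolve_left (mul_ne_zero (hσ a) (hσ b))
  linear_combination (p (σ a) (σ b) : k) * h3 + (p a b : k) * hp.mul_swap (σ a) (σ b)

/-- The relation that a skew derivation imposes on its matrix, tested against a functional. -/
theorem skewDerivation_quad {σ : Fin t → Fin t} {α : Fin t → k} {d : Fin t → Fin t → k}
    {g x : Module.End k (QuantumAffineSpace p)}
    (hx : ∀ a b, x (a * b) = x a * b + g a * x b)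
    (hg : ∀ a, g (gen p a) = α a • gen p (σ a)) (hd : ∀ a, x (gen p a) = ∑ c, d a c • gen p c)
    (M : Fin t → Fin t → k) (hM : ∀ a b, M a b = p a b * M b a) (a b : Fin t) :
    ∑ c, d a c * M c b + α a * ∑ c, d b c * M (σ a) c =
      p a b * (∑ c, d b c * M c a + α b * ∑ c, d a c * M (σ b) c) := by
  have h : x (gen p a * gen p b) = (p a b : k) • x (gen p b * gen p a) := by
    rw [gen_mul_gen, map_smul]
  have h := congrArg (quad M hM) h
  simpa only [hx, hg, hd, Finset.sum_mul, Finset.mul_sum, smul_mul_assoc, mul_smul_comm,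
    map_add, map_sum, map_smul, quad_gen_mul_gen, smul_eq_mul, mul_left_comm] using h

theorem skewDerivation_square (hp : IsMultAntisymm p) {σ : Fin t → Fin t} {α : Fin t → k}
    {d : Fin t → Fin t → k} {g x : Module.End k (QuantumAffineSpace p)}
    (hx : ∀ a b, x (a * b) = x a * b + g a * x b)
    (hg : ∀ a, g (gen p a) = α a • gen p (σ a)) (hd : ∀ a, x (gen p a) = ∑ c, d a c • gen p c)
    (a b i : Fin t) :
    (if b = i then d a i else 0) + α a * (if σ a = i then d b i else 0) =
      p a b * ((if a = i then d b i else 0) + α b * (if σ b = i then d a i else 0)) := by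
  have h := skewDerivation_quad hx hg hd (squareCoeff i) (squareCoeff_swap hp i) a b
  simpa only [squareCoeff, ite_and, mul_ite, mul_one, mul_zero, Finset.sum_ite_eq',
    Finset.sum_ite_irrel, Finset.sum_const_zero, Finset.mem_univ, if_true] using h

/-- This and `skewDerivation_square` read off degree-two coefficients after `x` is applied to `u_a
u_b = p_ab u_b u_a`. Suitable choices of `a, b, i, j` isolate single entries of `d`. -/
theorem skewDerivation_mixed (hp : IsMultAntisymm p) {σ : Fin t → Fin t} {α : Fin t → k}
    {d : Fin t → Fin t → k} {g x : Module.End k (QuantumAffineSpace p)}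
    (hx : ∀ a b, x (a * b) = x a * b + g a * x b)
    (hg : ∀ a, g (gen p a) = α a • gen p (σ a)) (hd : ∀ a, x (gen p a) = ∑ c, d a c • gen p c)
    (a b i j : Fin t) :
    ((if b = j then d a i else 0) + (if b = i then p j i * d a j else 0)) +
        α a * ((if σ a = i then d b j else 0) + (if σ a = j then p j i * d b i else 0)) =
      p a b * (((if a = j then d b i else 0) + (if a = i then p j i * d b j else 0)) +
        α b * ((if σ b = i then d a j else 0) + (if σ b = j then p j i * d a i else 0))) := by
  have h := skewDerivation_quad hx hg hd (mixedCoeff p i j) (mixedCoeff_swap hp i j) a b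
  have e1 : ∀ y s : Fin t, ∑ c, d y c * mixedCoeff p i j c s =
      (if s = j then d y i else 0) + (if s = i then p j i * d y j else 0) := by
    intro y s
    simp only [mixedCoeff, ite_and, mul_add, Finset.sum_add_distrib, mul_ite, mul_one, mul_zero,
      Finset.sum_ite_eq', Finset.mem_univ, if_true]
    congr 1
    split_ifs with hs
    · rw [hs, mul_comm]
    · rfl
  have e2 : ∀ y s : Fin t, ∑ c, d y c * mixedCoeff p i j s c =
      (if s = i then d y j else 0) + (if s = j then p j i * d y i else 0) := by
    intro y s
    simp only [mixedCoeff, ite_and, mul_add, Finset.sum_add_distrib, mul_ite, mul_one, mul_zero,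
      Finset.sum_ite_eq', Finset.sum_ite_irrel, Finset.sum_const_zero, Finset.mem_univ, if_true]
    congr 1
    split_ifs with hs
    · rw [hs, mul_comm]
    · rfl
  simpa only [e1, e2] using h

/-- A nonzero linear skew derivation twists along a diagonal automorphism. -/
theorem skewDerivation_eq_zero_of_moved (hp : IsMultAntisymm p)
    (hsq : ∀ a b, a ≠ b → (p a b : k) * p a b ≠ 1)
    {σ : Fin t → Fin t} {α : Fin t → k} {d : Fin t → Fin t → k} {q : k}
    {g x : Module.End k (QuantumAffineSpace p)}
    (hx : ∀ a b, x (a * b) = x a * b + g a * x b)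
    (hg : ∀ a, g (gen p a) = α a • gen p (σ a)) (hd : ∀ a, x (gen p a) = ∑ c, d a c • gen p c)
    (hσ : Function.Injective σ) (hα : ∀ a, α a ≠ 0)
    (hpσ : ∀ a b, a ≠ b → (p (σ a) (σ b) : k) = p a b)
    (hq : q ≠ 1) (hcomm : ∀ a c, d a c * α c = q * (α a * d (σ a) (σ c)))
    {m : Fin t} (hm : σ m ≠ m) (a c : Fin t) : d a c = 0 := by
  have hsurj : Function.Surjective σ := Finite.injective_iff_surjective.1 hσ
  have sq := skewDerivation_square hp hx hg hd
  have mix := skewDerivation_mixed hp hx hg hd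
  -- A 2-cycle would give `p_{σa,a} = p_{a,σa}`, hence `p_{a,σa}² = 1`.
  have hσ2 : ∀ a, σ a ≠ a → σ (σ a) ≠ a := by
    intro a ha h
    have h1 := hpσ a (σ a) ha.symm
    rw [h] at h1
    exact hsq a (σ a) ha.symm (by rw [← hp.mul_swap a (σ a), h1])
  have hmoved : ∀ a, σ a ≠ a → σ (σ a) ≠ σ a := fun a ha h => ha (hσ h)
  -- columns of moved indices
  have h1 : ∀ a b, σ a ≠ a → b ≠ a → b ≠ σ a → d b (σ a) = 0 := by
    intro a b ha hba hb
    have h := sq a b (σ a)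
    have hσb : σ b ≠ σ a := fun h => hba (hσ h)
    simp only [hb, if_false, if_true, ha.symm, hσb, mul_zero, zero_add] at h
    exact (mul_eq_zero.1 h).resolve_left (hα a)
  -- The coefficient of `u_a u_{σa}` equates the diagonal entries at `a` and `σ a`, while
  -- commutation with `g` makes them differ by the factor `q ≠ 1`; so they vanish.
  have h2 : ∀ a, σ a ≠ a → d a a = 0 := by
    intro a ha
    have hab := hσ2 a ha
    have hb := hmoved a ha
    have hd0 : d (σ a) a = 0 := by
      obtain ⟨a', rfl⟩ := hsurj a
      have ha' : σ a' ≠ a' := fun h => ha (congrArg σ h)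
      exact h1 a' _ ha' (hσ2 a' ha') ha
    have h := mix a (σ a) a (σ a)
    simp only [if_true, if_false, ha, ha.symm, hab, hb, hd0, mul_zero, add_zero, zero_add,
      ← mul_assoc, hp.mul_swap, one_mul] at h
    have h' := hcomm a a
    rw [← h] at h'
    have h3 : (1 - q) * α a * d a a = 0 := by linear_combination h'
    exact (mul_eq_zero.1 h3).resolve_left (mul_ne_zero (sub_ne_zero.2 hq.symm) (hα a))
  have h3 : ∀ b c, σ c ≠ c → d b c = 0 := by
    intro b c hc
    obtain ⟨a, rfl⟩ := hsurj c
    have ha : σ a ≠ a := fun h => hc (congrArg σ h)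
    by_cases hb : b = σ a
    · rw [hb]; exact h2 _ hc
    by_cases hba : b = a
    · subst hba
      have h := sq b (σ b) (σ b)
      simpa only [if_true, if_false, hc, ha.symm, h2 _ hc, mul_zero, add_zero] using h
    · exact h1 a b ha hba hb
  -- rows of moved indices
  have h4 : ∀ b f, σ b ≠ b → σ f = f → d b f = 0 := by
    intro b f hb hf
    obtain ⟨a, rfl⟩ := hsurj b
    have ha : σ a ≠ a := fun h => hb (congrArg σ h)
    have hbf : σ a ≠ f := fun h => hb (h ▸ hf)
    have hbbf : σ (σ a) ≠ f := fun h => hbf (hσ (h.trans hf.symm))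
    have haf : a ≠ f := fun h => ha (h ▸ hf)
    have h := mix a (σ a) f a
    simp only [if_true, if_false, ha, hbf, hbbf, haf, hσ2 a ha, mul_zero, add_zero] at h
    exact (mul_eq_zero.1 h.symm).resolve_left (Units.ne_zero _)
  -- Entries between fixed indices remain: the relation between `u_a` and a moved `u_m` isolates `d
  -- a c` in the coefficient of `u_c u_m`.
  by_cases hc : σ c = c
  · by_cases ha : σ a = a
    · have ham : a ≠ m := fun h => hm (h ▸ ha)
      have hmc : m ≠ c := fun h => hm (h ▸ hc)
      have hσm : σ m ≠ c := fun h => hmc (hσ (h.trans hc.symm))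
      have h := mix a m c m
      simpa only [if_true, if_false, ha, ham, hmc, hm, hσm, h3 m m hm, h3 a m hm, mul_zero,
        add_zero, ite_self] using h
    · exact h4 a c ha hc
  · exact h3 a c hc

/-- The scalars by which a diagonal automorphism acts are determined by any nonzero entry of a
skew derivation that twists along it. -/
theorem skewDerivation_diagonal (hp : IsMultAntisymm p)
    {α : Fin t → k} {d : Fin t → Fin t → k} {q : k}
    {g x : Module.End k (QuantumAffineSpace p)}
    (hx : ∀ a b, x (a * b) = x a * b + g a * x b)
    (hg : ∀ a, g (gen p a) = α a • gen p a) (hd : ∀ a, x (gen p a) = ∑ c, d a c • gen p c)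
    (hα : ∀ a, α a ≠ 0) (hq : q ≠ 1) (hcomm : ∀ a c, d a c * α c = q * (α a * d a c))
    {a c : Fin t} (hac : d a c ≠ 0) :
    c ≠ a ∧ α c = q * α a ∧ ∀ b, b ≠ a → α b = p b a * p c b := by
  have h1 : α c = q * α a := mul_left_cancel₀ hac (by rw [hcomm]; ring)
  have hca : c ≠ a := by
    rintro rfl
    have h : (1 - q) * α c = 0 := by linear_combination h1
    exact (mul_eq_zero.1 h).elim (fun h => hq (sub_eq_zero.1 h).symm) (hα c)
  refine ⟨hca, h1, fun b hb => ?_⟩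
  by_cases hbc : b = c
  · subst hbc
    have h := skewDerivation_square hp (σ := id) hx hg hd a b b
    simp only [id, if_true, if_false, hca.symm, mul_zero, add_zero, zero_add] at h
    have h2 : d a b * (1 - p a b * α b) = 0 := by linear_combination h
    have h3 := (mul_eq_zero.1 h2).resolve_left hac
    rw [hp.self, mul_one]
    linear_combination (-(p b a) : k) * h3 - α b * hp.mul_swap a b
  · have h := skewDerivation_mixed hp (σ := id) hx hg hd a b c b
    simp only [id, if_true, if_false, hbc, hb.symm, hca.symm, mul_zero, add_zero, zero_add] at h
    have h2 : d a c * (1 - p a b * α b * p b c) = 0 := by linear_combination h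
    have h3 := (mul_eq_zero.1 h2).resolve_left hac
    linear_combination (-(p b a) * p c b : k) * h3 - α b * hp.mul_swap a b
      - p a b * p b a * α b * hp.mul_swap b c

end LinearMaps

/-! ### The upper bound on the rank. -/

section RankBound

variable {k : Type u} [Field k] {G : Type v} [CommGroup G] {θ t : ℕ} {D : QLSDatum k G θ}
  {p : Fin t → Fin t → kˣ} {ρ : D.Bosonization →ₐ[k] Module.End k (QuantumAffineSpace p)}

/-- The normal form of a linear inner faithful action on the generators. -/
theorem exists_diagonal_action (hp : IsMultAntisymm p)
    (hsq : ∀ a b, a ≠ b → (p a b : k) * p a b ≠ 1) (hρ : IsHopfAction ρ)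
    (hlin : IsLinearAction D p ρ) (hf : IsInnerFaithful ρ) (i : Fin θ) :
    ∃ (α : Fin t → k) (d : Fin t → Fin t → k),
      (∀ a, ρ (D.grp (D.g i)) (gen p a) = α a • gen p a) ∧ (∀ a, α a ≠ 0) ∧
      (∀ a, ρ (D.x i) (gen p a) = ∑ c, d a c • gen p c) ∧ (∃ a c, d a c ≠ 0) ∧
      ∀ a c, d a c ≠ 0 →
        c ≠ a ∧ α c = (D.χ i (D.g i) : k) * α a ∧ ∀ b, b ≠ a → α b = p b a * p c b := by
  have hne : ∀ a b, a ≠ b → (p a b : k) ≠ 1 := fun a b hab h =>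
    hsq a b hab (by rw [h, one_mul])
  have hinj : Function.Injective (ρ (D.grp (D.g i))) :=
    Function.LeftInverse.injective (g := ρ (D.grp (D.g i)⁻¹)) (rep_grp_inv_grp ρ (D.g i))
  obtain ⟨σ, α, hσ, hα, hg, hpσ⟩ := exists_monomial hp hne (hρ.grp_mul (D.g i)) hinj
    (fun a => (hlin i _ (gen_mem_degreeOne a)).1)
  obtain ⟨a0, ha0⟩ := hf.exists_x_gen_ne_zero hρ i
  set d : Fin t → Fin t → k := fun a c => coeff p c (ρ (D.x i) (gen p a)) with hd'
  have hd : ∀ a, ρ (D.x i) (gen p a) = ∑ c, d a c • gen p c := fun a =>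
    mem_degreeOne_iff.1 (hlin i _ (gen_mem_degreeOne a)).2
  have hq : (D.χ i (D.g i) : k) ≠ 1 := by
    intro h
    have h2 := D.two_le_order i
    rw [Units.val_eq_one.1 h, orderOf_one] at h2
    omega
  -- Compare the coefficients of `u_{σ c}` in `g_i x_i = χ_i(g_i) x_i g_i` applied to `u_a`.
  have hcomm : ∀ a c, d a c * α c = (D.χ i (D.g i) : k) * (α a * d (σ a) (σ c)) := by
    intro a c
    have h := congrArg (coeff p (σ c)) (rep_grp_x ρ (D.g i) i (gen p a))
    simpa [hd, hg, coeff_gen, hσ.eq_iff] using h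
  have hex : ∃ a c, d a c ≠ 0 := by
    by_contra! h
    exact ha0 (by simp [hd, h])
  have hid : ∀ a, σ a = a := by
    by_contra! h
    obtain ⟨m, hm⟩ := h
    obtain ⟨a, c, hac⟩ := hex
    exact hac (skewDerivation_eq_zero_of_moved hp hsq (hρ.x_mul i) hg hd hσ hα hpσ hq hcomm
      hm a c)
  have hg' : ∀ a, ρ (D.grp (D.g i)) (gen p a) = α a • gen p a := fun a => by rw [hg, hid]
  refine ⟨α, d, hg', hα, hd, hex, fun a c hac => ?_⟩
  exact skewDerivation_diagonal hp (hρ.x_mul i) hg' hd hα hq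
    (fun a c => by rw [hcomm, hid, hid]) hac

/-- Nilpotent operators that commute up to scalars and act monomially on a nonempty family have a
common zero in the family. -/
theorem exists_common_zero {V ι κ : Type*} [AddCommGroup V] [Module k V] [Nonempty κ] (u : κ → V)
    (y : ι → Module.End k V) (hnil : ∀ i, IsNilpotent (y i))
    (hcomm : ∀ i j, ∃ c : k, y i * y j = c • (y j * y i))
    (hmon : ∀ i a, ∃ (c : k) (b : κ), y i (u a) = c • u b) (s : Finset ι) :
    ∃ a, ∀ i ∈ s, y i (u a) = 0 := by
  classical
  induction s using Finset.induction with
  | empty => simp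
  | insert i s _ ih =>
    obtain ⟨n, hn⟩ := hnil i
    -- If `y i` does not kill `u a`, move to the `u b` on the line of `y i (u a)`. The operators in
    -- `s` still kill it since they commute with `y i` up to scalars, and the exponent `n` drops.
    have key : ∀ n : ℕ, ∀ a, (y i ^ n) (u a) = 0 → (∀ j ∈ s, y j (u a) = 0) →
        ∃ a, ∀ j ∈ insert i s, y j (u a) = 0 := by
      intro n
      induction n with
      | zero =>
        intro a ha hs
        have ha : u a = 0 := by simpa using ha
        exact ⟨a, fun j _ => by rw [ha, map_zero]⟩
      | succ n ihn =>
        intro a ha hs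
        by_cases h0 : y i (u a) = 0
        · exact ⟨a, by simpa [h0] using hs⟩
        obtain ⟨c, b, hb⟩ := hmon i a
        have hc : c ≠ 0 := fun hc => h0 (by rw [hb, hc, zero_smul])
        refine ihn b ?_ fun j hj => ?_
        · rw [pow_succ, Module.End.mul_apply, hb, map_smul] at ha
          exact (smul_eq_zero.1 ha).resolve_left hc
        · obtain ⟨e, he⟩ := hcomm j i
          have h := LinearMap.congr_fun he (u a)
          rw [Module.End.mul_apply, hb, map_smul, LinearMap.smul_apply, Module.End.mul_apply,
            hs j hj, map_zero, smul_zero] at h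
          exact (smul_eq_zero.1 h).resolve_left hc
    obtain ⟨a, ha⟩ := ih
    exact key n a (by rw [hn]; rfl) ha

/-- A source of `x_i` is a generator that it does not kill. The count is at most two indices per
source, with the common zero `u_z` excluded as a source. -/
theorem IsLinearAction.rank_le (hp : IsMultAntisymm p) (ht : 0 < t)
    (hsq : ∀ a b, a ≠ b → (p a b : k) * p a b ≠ 1) (hm : ∀ i, 3 ≤ D.m i) (hρ : IsHopfAction ρ)
    (hlin : IsLinearAction D p ρ) (hf : IsInnerFaithful ρ) : θ ≤ 2 * (t - 1) := by
  classical
  choose α d hg hα hd hex hdiag using exists_diagonal_action hp hsq hρ hlin hf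
  -- Two targets `c ≠ c'` for the same `a` give two values for the eigenvalue at `c'`, namely
  -- `p_{c'a} p_{cc'}` and `p_{c'a}`, so `p_{cc'} = 1`.
  have hrow : ∀ i a c c', d i a c ≠ 0 → d i a c' ≠ 0 → c = c' := by
    intro i a c c' h h'
    obtain ⟨hca, h1, h2⟩ := hdiag i a c h
    obtain ⟨hca', h1', h2'⟩ := hdiag i a c' h'
    by_contra hne
    have e1 := h2 c hca
    have e2 := h2 c' hca'
    have e3 := h2' c' hca'
    rw [hp.self, mul_one] at e1 e3
    have e4 : (p c c' : k) = 1 := by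
      refine mul_left_cancel₀ (hα i c') ?_
      rw [mul_one]
      conv_rhs => rw [e2]
      rw [e3]
    exact hsq c c' hne (by rw [e4, one_mul])
  have hmon : ∀ i a, ∃ (c : k) (b : Fin t), ρ (D.x i) (gen p a) = c • gen p b := by
    intro i a
    by_cases h : ∃ c, d i a c ≠ 0
    · obtain ⟨c, hc⟩ := h
      refine ⟨d i a c, c, ?_⟩
      rw [hd, Finset.sum_eq_single c]
      · intro b _ hb
        by_contra h
        exact hb (hrow i a b c (fun h0 => h (by rw [h0, zero_smul])) hc)
      · simp
    · push Not at h
      exact ⟨0, a, by simp [hd, h]⟩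
  have : Nonempty (Fin t) := ⟨⟨0, ht⟩⟩
  obtain ⟨z, hz⟩ := exists_common_zero (gen p) (fun i => ρ (D.x i))
    (fun i => ⟨D.m i, by rw [← map_pow, D.x_pow_m, map_zero]⟩)
    (fun i j => by
      by_cases hij : i = j
      · exact ⟨1, by rw [hij, one_smul]⟩
      · exact ⟨_, by rw [← map_mul, D.x_mul_x hij, map_smul, map_mul]⟩)
    hmon Finset.univ
  have hz : ∀ i c, d i z c = 0 := by
    intro i c
    have h := congrArg (coeff p c) (hz i (Finset.mem_univ i))
    rwa [hd, coeff_sum_gen, map_zero] at h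
  choose s c hsc using hex
  have hχ : ∀ i j a c, d j a c ≠ 0 → α i c = (D.χ j (D.g i) : k) * α i a := by
    intro i j a c hc
    have h := congrArg (coeff p c) (rep_grp_x ρ (D.g i) j (gen p a))
    simp only [hd, hg, map_sum, map_smul, coeff_gen, smul_eq_mul, mul_ite, mul_one, mul_zero,
      Finset.sum_ite_eq', Finset.mem_univ, if_true] at h
    refine mul_left_cancel₀ hc ?_
    linear_combination h
  -- With targets `c_i`, `c_j`, the products `α_i(c_i) α_j(c_j)` and `α_i(c_j) α_j(c_i)` agree
  -- because `p_{c_i c_j} p_{c_j c_i} = 1`. Relative to the source, the first contributes `χ_i(g_i)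
  -- χ_j(g_j)` and the second `χ_j(g_i) χ_i(g_j) = 1`.
  have hqq : ∀ i j, i ≠ j → s i = s j → (D.χ i (D.g i) : k) * D.χ j (D.g j) = 1 := by
    intro i j hij hs
    have hi := hsc i
    have hj := hsc j
    rw [hs] at hi
    obtain ⟨hb, hb1, hb2⟩ := hdiag i _ _ hi
    obtain ⟨hc, hc1, hc2⟩ := hdiag j _ _ hj
    have e1 := hχ i j _ _ hj
    have e2 := hχ j i _ _ hi
    have e3 : (D.χ i (D.g j) : k) * D.χ j (D.g i) = 1 := by
      rw [D.compat i j hij, Units.inv_mul]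
    have f1 := hb2 _ hc
    have f2 := hc2 _ hb
    have f3 := hb2 _ hb
    have f4 := hc2 _ hc
    rw [hp.self, mul_one] at f3 f4
    have h := hp.mul_swap (c i) (c j)
    refine mul_right_cancel₀ (mul_ne_zero (hα i (s j)) (hα j (s j))) ?_
    calc (D.χ i (D.g i) : k) * D.χ j (D.g j) * (α i (s j) * α j (s j))
        = α i (c i) * α j (c j) := by rw [hb1, hc1]; ring
      _ = (p (c i) (s j) * p (c j) (s j)) * (p (c i) (c j) * p (c j) (c i)) := by
          rw [f3, f4, h, mul_one]
      _ = α i (c j) * α j (c i) := by rw [f1, f2]; ring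
      _ = (D.χ i (D.g j) : k) * D.χ j (D.g i) * (α i (s j) * α j (s j)) := by
          rw [e1, e2]; ring
      _ = 1 * (α i (s j) * α j (s j)) := by rw [e3]
  have hfib : ∀ a ∈ Finset.univ.erase z, (Finset.univ.filter fun i => s i = a).card ≤ 2 := by
    intro a _
    -- Three parameters with pairwise products 1 are equal in pairs and so square to 1.
    by_contra! h
    obtain ⟨i, j, l, hi, hj, hl, hij, hil, hjl⟩ := Finset.two_lt_card_iff.1 h
    simp only [Finset.mem_filter, Finset.mem_univ, true_and] at hi hj hl
    have e1 := hqq i j hij (hi.trans hj.symm)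
    have e2 := hqq i l hil (hi.trans hl.symm)
    have e3 := hqq j l hjl (hj.trans hl.symm)
    have e4 : (D.χ j (D.g j) : k) = D.χ l (D.g l) :=
      mul_left_cancel₀ (Units.ne_zero _) (e1.trans e2.symm)
    rw [← e4, ← Units.val_mul, Units.val_eq_one, ← pow_two] at e3
    have h1 := Nat.le_of_dvd two_pos (orderOf_dvd_of_pow_eq_one e3)
    have h2 : 3 ≤ orderOf (D.χ j (D.g j)) := hm j
    omega
  have hmaps : ∀ i ∈ (Finset.univ : Finset (Fin θ)), s i ∈ Finset.univ.erase z := by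
    intro i _
    refine Finset.mem_erase.2 ⟨fun h => hsc i ?_, Finset.mem_univ _⟩
    rw [h, hz]
  have := Finset.card_le_mul_card_image_of_maps_to hmaps 2 hfib
  simpa [Finset.card_erase_of_mem] using this

end RankBound

/-! ### Diagonal automorphisms and the skew derivations twisted by them. -/

section Construction

variable {k : Type u} [Field k] {G : Type v} [CommGroup G] {θ : ℕ} {D : QLSDatum k G θ}

/-- To be a Hopf action can be checked on the generators of the bosonization. -/
theorem isHopfAction_of_generators {A : Type w} [Ring A] [Algebra k A]
    {ρ : D.Bosonization →ₐ[k] Module.End k A} (hg1 : ∀ h, ρ (D.grp h) 1 = 1)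
    (hg : ∀ h a b, ρ (D.grp h) (a * b) = ρ (D.grp h) a * ρ (D.grp h) b)
    (hx : ∀ i a b, ρ (D.x i) (a * b) = ρ (D.x i) a * b + ρ (D.grp (D.g i)) a * ρ (D.x i) b) :
    IsHopfAction ρ := by
  have hx1 : ∀ i, ρ (D.x i) 1 = 0 := by
    intro i
    simpa [hg1] using hx i 1 1
  constructor
  · intro b
    rw [QLSDatum.counit_eq]
    induction b using D.induction with
    | hs r => simp [Algebra.algebraMap_eq_smul_one]
    | hg h => simp [hg1]
    | hx i => simp [hx1]
    | hm a b ha hb =>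
      rw [map_mul, Module.End.mul_apply, hb, Algebra.algebraMap_eq_smul_one, map_smul, ha]
      rw [map_mul, map_mul, Algebra.smul_def, Algebra.commutes]
    | ha a b ha hb => rw [map_add, LinearMap.add_apply, ha, hb, map_add, map_add]
  · intro b
    rw [QLSDatum.comul_eq]
    induction b using D.induction with
    | hs r =>
      intro a a'
      simp [Algebra.algebraMap_eq_smul_one, Algebra.TensorProduct.one_def]
    | hg h => intro a a'; simp [hg]
    | hx i => intro a a'; simp [hx]
    | ha b c hb hc =>
      intro a a'
      simp only [map_add, LinearMap.add_apply, hb, hc]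
    | hm b c hb hc =>
      intro a a'
      rw [map_mul ρ, Module.End.mul_apply, hc, map_mul]
      induction D.comulHom c using TensorProduct.induction_on with
      | zero => simp
      | add y z hy hz => simp only [mul_add, map_add, LinearMap.add_apply, hy, hz]
      | tmul y z =>
        rw [TensorProduct.map₂_apply_tmul, TensorProduct.map_tmul, LinearMap.mul'_apply, hb]
        induction D.comulHom b using TensorProduct.induction_on with
        | zero => simp
        | add y z hy hz => simp only [add_mul, map_add, LinearMap.add_apply, hy, hz]
        | tmul y' z' => simp

/-- The Leibniz rule for the `m`-th power of a skew derivation whose parameter is a primitive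
`m`-th root of unity. -/
theorem skewDerivation_pow {A : Type w} [Ring A] [Algebra k A] {g x : Module.End k A} {q : k}
    {m : ℕ} (hm : 1 ≤ m) (hq : IsPrimitiveRoot q m)
    (hx : ∀ a b, x (a * b) = x a * b + g a * x b) (hgx : g * x = q • (x * g)) (a b : A) :
    (x ^ m) (a * b) = (x ^ m) a * b + (g ^ m) a * (x ^ m) b := by
  -- On products `x` lifts to `X + Y` along the multiplication map. As `Y X = q X Y`, the mixed
  -- terms of `(X + Y)^m` vanish by the `q`-binomial theorem.
  let X : Module.End k (A ⊗[k] A) := TensorProduct.map x 1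
  let Y : Module.End k (A ⊗[k] A) := TensorProduct.map g x
  have hYX : Y * X = q • (X * Y) := by
    simp only [X, Y, ← TensorProduct.map_mul, hgx, one_mul, mul_one, TensorProduct.map_smul_left]
  have hX : X ^ m = TensorProduct.map (x ^ m) 1 := by
    rw [TensorProduct.map_pow, one_pow]
  have hY : Y ^ m = TensorProduct.map (g ^ m) (x ^ m) := TensorProduct.map_pow _ _ _
  have key : ∀ n : ℕ, ∀ z : A ⊗[k] A,
      (x ^ n) (LinearMap.mul' k A z) = LinearMap.mul' k A (((X + Y) ^ n) z) := by
    intro n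
    induction n with
    | zero => simp
    | succ n ih =>
      intro z
      rw [pow_succ, pow_succ, Module.End.mul_apply, Module.End.mul_apply, ← ih]
      congr 1
      induction z using TensorProduct.induction_on with
      | zero => simp
      | add y z hy hz => simp only [map_add, hy, hz]
      | tmul y z => simp [X, Y, hx]
  have h := key m (a ⊗ₜ b)
  rw [add_pow_of_qCommute hm hYX hq, hX, hY] at h
  simpa using h

variable {t : ℕ} {p : Fin t → Fin t → kˣ} (β : Fin t → G →* kˣ)

variable (p) in
/-- The diagonal action of a group element. -/
noncomputable def diagonalHom (h : G) : QuantumAffineSpace p →ₐ[k] QuantumAffineSpace p :=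
  lift (fun c => (β c h : k) • gen p c) (fun i j => by
    rw [smul_mul_smul_comm, smul_mul_smul_comm, gen_mul_gen, smul_smul, smul_smul]
    congr 1
    ring)

@[simp]
theorem diagonalHom_gen (h : G) (c : Fin t) :
    diagonalHom p β h (gen p c) = (β c h : k) • gen p c := by
  simp [diagonalHom]

theorem diagonalHom_one : diagonalHom p β 1 = AlgHom.id k _ := by
  ext a
  induction a using QuantumAffineSpace.induction with
  | hs r => simp
  | hg i => simp
  | hm a b ha hb => rw [map_mul, map_mul, ha, hb]
  | ha a b ha hb => rw [map_add, map_add, ha, hb]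

theorem diagonalHom_mul (h h' : G) :
    diagonalHom p β (h * h') = (diagonalHom p β h).comp (diagonalHom p β h') := by
  ext a
  induction a using QuantumAffineSpace.induction with
  | hs r => simp
  | hg i => simp [smul_smul, mul_comm]
  | hm a b ha hb => rw [map_mul, map_mul, ha, hb]
  | ha a b ha hb => rw [map_add, map_add, ha, hb]

theorem diagonalHom_comm (h h' : G) (a : QuantumAffineSpace p) :
    diagonalHom p β h (diagonalHom p β h' a) = diagonalHom p β h' (diagonalHom p β h a) := by
  rw [← AlgHom.comp_apply, ← AlgHom.comp_apply, ← diagonalHom_mul, ← diagonalHom_mul, mul_comm]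

variable (hp : IsMultAntisymm p) {a b : Fin t} {g : G}
  (hβ : ∀ c, c ≠ a → (β c g : k) = p c a * p b c)

/-- The upper triangular matrices over quantum affine space that encode a skew derivation. -/
noncomputable def shiftMatrixHom :
    QuantumAffineSpace p →ₐ[k] Matrix (Fin 2) (Fin 2) (QuantumAffineSpace p) :=
  lift (fun c => !![(β c g : k) • gen p c, if c = a then gen p b else 0; 0, gen p c])
    (by
      -- The prescribed eigenvalue makes `u_b` commute, up to the twist, with `u_c` exactly as `u_a`
      -- does; this is what compatibility with the relations requires.
      have aux : ∀ c, c ≠ a → (β c g : k) • (gen p c * gen p b) =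
          (p c a : k) • (gen p b * gen p c) := by
        intro c hc
        rw [hβ c hc, gen_mul_gen c b, smul_smul, mul_assoc, hp.mul_swap, mul_one]
      intro i j
      simp only [Matrix.mul_fin_two, Matrix.smul_of, Matrix.smul_cons, Matrix.smul_empty,
        mul_zero, zero_mul, add_zero, zero_add, smul_zero]
      congr 3
      · rw [smul_mul_smul_comm, smul_mul_smul_comm, gen_mul_gen i j, smul_smul, smul_smul]
        congr 1
        ring
      · by_cases hi : i = a <;> by_cases hj : j = a
        · subst hi; subst hj; simp [hp.self]
        · subst hi
          simp only [if_true, hj, if_false, mul_zero, zero_mul, zero_add, add_zero, smul_mul_assoc]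
          rw [aux j hj, smul_smul, hp.mul_swap, one_smul]
        · subst hj
          simp only [if_true, hi, if_false, mul_zero, zero_mul, zero_add, add_zero,
            smul_mul_assoc]
          rw [aux i hi]
        · simp [hi, hj]
      · rw [gen_mul_gen i j])

theorem shiftMatrixHom_apply (y : QuantumAffineSpace p) :
    shiftMatrixHom β hp hβ y =
      !![diagonalHom p β g y, shiftMatrixHom β hp hβ y 0 1; 0, y] := by
  induction y using QuantumAffineSpace.induction with
  | hs r =>
    rw [AlgHom.commutes, AlgHom.commutes]
    ext i j
    fin_cases i <;> fin_cases j <;> simp [Matrix.algebraMap_matrix_apply]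
  | hg i => simp [shiftMatrixHom]
  | hm y z hy hz =>
    rw [map_mul, hy, hz]
    simp
  | ha y z hy hz =>
    rw [map_add, hy, hz]
    simp

/-- The skew derivation with `u_a ↦ u_b` that kills the other generators. -/
noncomputable def shift : Module.End k (QuantumAffineSpace p) :=
  Matrix.entryLinearMap k _ 0 1 ∘ₗ (shiftMatrixHom β hp hβ).toLinearMap

theorem shift_gen (c : Fin t) :
    shift β hp hβ (gen p c) = if c = a then gen p b else 0 := by
  simp [shift, shiftMatrixHom]

theorem shift_mul (y z : QuantumAffineSpace p) :
    shift β hp hβ (y * z) = shift β hp hβ y * z + diagonalHom p β g y * shift β hp hβ z := by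
  have e : ∀ y, shift β hp hβ y = shiftMatrixHom β hp hβ y 0 1 := fun _ => rfl
  simp only [e]
  rw [map_mul, shiftMatrixHom_apply β hp hβ y, shiftMatrixHom_apply β hp hβ z]
  simp [add_comm]

end Construction

/-! ### The action of a bosonization by shifts onto one generator. -/

section ShiftAction

variable {k : Type u} [Field k] {G : Type v} [CommGroup G] {θ : ℕ} (D : QLSDatum k G θ)
  {t : ℕ} {p : Fin t → Fin t → kˣ} (β : Fin t → G →* kˣ) (hp : IsMultAntisymm p)
  {b : Fin t} {src : Fin θ → Fin t} (hsrc : ∀ i, src i ≠ b)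
  (hχ : ∀ i h, D.χ i h = β b h / β (src i) h)
  (hβ : ∀ i c, c ≠ src i → (β c (D.g i) : k) = p c (src i) * p b c)

include hχ in
theorem diagonalHom_mul_shift (h : G) (i : Fin θ) :
    (diagonalHom p β h).toLinearMap * shift β hp (hβ i) =
      (D.χ i h : k) • (shift β hp (hβ i) * (diagonalHom p β h).toLinearMap) := by
  refine skewDerivation_ext (φ := fun y => diagonalHom p β h (diagonalHom p β (D.g i) y))
    (ψ := diagonalHom p β h) (by simp) (by simp) ?_ ?_ ?_
  · intro y z
    simp [shift_mul, add_comm]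
  · intro y z
    simp only [LinearMap.smul_apply, Module.End.mul_apply, AlgHom.toLinearMap_apply, map_mul,
      shift_mul, smul_add, mul_smul_comm, smul_mul_assoc, add_comm, diagonalHom_comm β h]
  · intro c
    by_cases hc : c = src i
    · subst hc
      simp [shift_gen, hχ, smul_smul]
    · simp [shift_gen, hc]

include hsrc hχ in
-- The cross terms in the Leibniz rule cancel by `χ_j(g_i) χ_i(g_j) = 1`, so the difference of the
-- two sides is a skew derivation twisted by `g_i g_j`. It kills the generators: every shift lands
-- on `u_b`, which is no source.
theorem shift_mul_shift {i j : Fin θ} (hij : i ≠ j) :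
    shift β hp (hβ i) * shift β hp (hβ j) =
      (D.χ j (D.g i) : k) • (shift β hp (hβ j) * shift β hp (hβ i)) := by
  have e1 := fun y => LinearMap.congr_fun (diagonalHom_mul_shift D β hp hχ hβ (D.g i) j) y
  have e2 := fun y => LinearMap.congr_fun (diagonalHom_mul_shift D β hp hχ hβ (D.g j) i) y
  simp only [LinearMap.smul_apply, Module.End.mul_apply, AlgHom.toLinearMap_apply] at e1 e2
  have hc : (D.χ j (D.g i) : k) * D.χ i (D.g j) = 1 := by
    rw [D.compat i j hij, Units.mul_inv]
  rw [← sub_eq_zero]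
  refine skewDerivation_ext
    (φ := fun y => diagonalHom p β (D.g i) (diagonalHom p β (D.g j) y))
    (ψ := id) (by simp) rfl ?_ (by simp) ?_
  · intro y z
    simp only [LinearMap.sub_apply, LinearMap.smul_apply, Module.End.mul_apply, map_add, shift_mul,
      smul_add, e1, e2, smul_mul_assoc, diagonalHom_comm β (D.g j) (D.g i), smul_smul, hc,
      one_smul, mul_sub, sub_mul, mul_smul_comm, id]
    abel
  · intro c
    simp [shift_gen, apply_ite, (hsrc _).symm]

include hsrc hχ in
-- The `m_i`-th power is again a skew derivation, and already the square kills the generators.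
theorem shift_pow (i : Fin θ) : shift β hp (hβ i) ^ D.m i = 0 := by
  have hq : IsPrimitiveRoot (D.χ i (D.g i) : k) (D.m i) :=
    (IsPrimitiveRoot.orderOf (D.χ i (D.g i))).map_of_injective
      (f := Units.coeHom k) Units.val_injective
  have h := skewDerivation_pow (D.m_pos i) hq (shift_mul β hp (hβ i))
    (diagonalHom_mul_shift D β hp hχ hβ (D.g i) i)
  refine skewDerivation_ext
    (φ := fun y => ((diagonalHom p β (D.g i)).toLinearMap ^ D.m i) y) (ψ := id) ?_ rfl
    (fun y z => by rw [h, add_comm]; rfl) (by simp) ?_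
  · induction D.m i with
    | zero => simp
    | succ n ih => rw [pow_succ, Module.End.mul_apply]; simpa using ih
  · intro c
    obtain ⟨n, hn⟩ := Nat.exists_eq_add_of_le (show 2 ≤ D.m i from D.two_le_order i)
    rw [hn, add_comm, pow_add, pow_two]
    simp [shift_gen, apply_ite, (hsrc _).symm]

/-- The action of a bosonization in which each `x i` moves the generator with index `src i` to the
one with index `b`. -/
noncomputable def shiftAction : D.Bosonization →ₐ[k] Module.End k (QuantumAffineSpace p) :=
  D.lift (fun h => (diagonalHom p β h).toLinearMap) (fun i => shift β hp (hβ i))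
    (by rw [diagonalHom_one]; rfl)
    (fun h h' => by rw [diagonalHom_mul]; rfl)
    (diagonalHom_mul_shift D β hp hχ hβ) (shift_pow D β hp hsrc hχ hβ)
    (fun _ _ => shift_mul_shift D β hp hsrc hχ hβ)

@[simp]
theorem shiftAction_grp (h : G) (y : QuantumAffineSpace p) :
    shiftAction D β hp hsrc hχ hβ (D.grp h) y = diagonalHom p β h y := by
  simp [shiftAction]

@[simp]
theorem shiftAction_x (i : Fin θ) :
    shiftAction D β hp hsrc hχ hβ (D.x i) = shift β hp (hβ i) := by
  simp [shiftAction]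

theorem isHopfAction_shiftAction : IsHopfAction (shiftAction D β hp hsrc hχ hβ) :=
  isHopfAction_of_generators (by simp) (by simp) (by simp [shift_mul])

theorem isLinearAction_shiftAction : IsLinearAction D p (shiftAction D β hp hsrc hχ hβ) := by
  intro i y hy
  obtain ⟨f, rfl⟩ := (Submodule.mem_span_range_iff_exists_fun k).1 hy
  simp only [map_sum, map_smul, shiftAction_grp, shiftAction_x, diagonalHom_gen, shift_gen]
  constructor
  · exact Submodule.sum_mem _ fun c _ =>
      Submodule.smul_mem _ _ (Submodule.smul_mem _ _ (gen_mem_degreeOne c))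
  · refine Submodule.sum_mem _ fun c _ => Submodule.smul_mem _ _ ?_
    split_ifs
    · exact gen_mem_degreeOne b
    · exact Submodule.zero_mem _

end ShiftAction

/-! ### Translates, ordered monomials, and a criterion for a Hopf ideal to vanish. -/

namespace QLSDatum

variable {k : Type u} [Field k] {G : Type v} [CommGroup G] {θ : ℕ} (D : QLSDatum k G θ)

section Translates

/-- The right translate `(id ⊗ φ) ∘ Δ` by a functional `φ`. -/
noncomputable def translate (φ : D.Bosonization →ₗ[k] k) : D.Bosonization →ₗ[k] D.Bosonization :=
  (TensorProduct.rid k D.Bosonization).toLinearMap ∘ₗ φ.lTensor D.Bosonization ∘ₗ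
    D.comulHom.toLinearMap

theorem translate_grp (φ : D.Bosonization →ₗ[k] k) (h : G) :
    D.translate φ (D.grp h) = φ (D.grp h) • D.grp h := by
  simp [translate]

theorem translate_x (φ : D.Bosonization →ₗ[k] k) (i : Fin θ) :
    D.translate φ (D.x i) = φ 1 • D.x i + φ (D.x i) • D.grp (D.g i) := by
  simp [translate]

theorem translate_mul {φ φ₁ φ₂ φ₃ φ₄ : D.Bosonization →ₗ[k] k}
    (h : ∀ y z, φ (y * z) = φ₁ y * φ₂ z + φ₃ y * φ₄ z) (y z : D.Bosonization) :
    D.translate φ (y * z) =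
      D.translate φ₁ y * D.translate φ₂ z + D.translate φ₃ y * D.translate φ₄ z := by
  simp only [translate, LinearMap.comp_apply, AlgHom.toLinearMap_apply, map_mul]
  induction D.comulHom y using TensorProduct.induction_on with
  | zero => simp
  | add y₁ y₂ h₁ h₂ =>
    simp only [add_mul, map_add, h₁, h₂]
    abel
  | tmul y₁ y₂ =>
    induction D.comulHom z using TensorProduct.induction_on with
    | zero => simp
    | add z₁ z₂ h₁ h₂ =>
      simp only [mul_add, map_add, h₁, h₂]
      abel
    | tmul z₁ z₂ =>
      simp [h, add_smul, smul_smul, mul_comm]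

/-- `Δ(I)` dies in `B/I ⊗ B/I`, and `φ` factors through `B/I`; hence `(id ⊗ φ)Δ` maps `I` to zero in
`B/I`. -/
theorem translate_mem {I : Ideal D.Bosonization} (hI : I.IsHopfIdeal k)
    {φ : D.Bosonization →ₗ[k] k} (hφ : ∀ y ∈ I, φ y = 0) {y : D.Bosonization} (hy : y ∈ I) :
    D.translate φ y ∈ I := by
  set J := I.restrictScalars k
  have h0 : TensorProduct.map J.mkQ J.mkQ (D.comulHom y) = 0 := hI.map_mkQ_comul_eq_zero hy
  have key : ∀ z : D.Bosonization ⊗[k] D.Bosonization,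
      J.mkQ (TensorProduct.rid k D.Bosonization (φ.lTensor D.Bosonization z)) =
        TensorProduct.rid k _ ((J.liftQ φ hφ).lTensor _ (TensorProduct.map J.mkQ J.mkQ z)) := by
    intro z
    induction z using TensorProduct.induction_on with
    | zero => simp
    | add y z hy hz => simp only [map_add, hy, hz]
    | tmul y z =>
      simp only [LinearMap.lTensor_tmul, TensorProduct.rid_tmul, TensorProduct.map_tmul, map_smul]
      rfl
  have h1 := key (D.comulHom y)
  rw [h0, map_zero, map_zero] at h1
  exact (Submodule.Quotient.mk_eq_zero J).1 h1

end Translates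

section Spanning

/-- The span of the ordered monomials in the `x i` with `i` in a list. -/
noncomputable def monomialSpan : List (Fin θ) → Submodule k D.Bosonization
  | [] => Submodule.span k {1}
  | i :: L =>
    { carrier := {w | ∃ f : ℕ → monomialSpan L,
        w = ∑ n ∈ Finset.range (D.m i), D.x i ^ n * (f n : D.Bosonization)}
      add_mem' := by
        rintro _ _ ⟨f, rfl⟩ ⟨f', rfl⟩
        exact ⟨f + f', by simp [mul_add, Finset.sum_add_distrib]⟩
      zero_mem' := ⟨0, by simp⟩
      smul_mem' := by
        rintro r _ ⟨f, rfl⟩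
        exact ⟨r • f, by simp [Finset.smul_sum]⟩ }

variable {D}

theorem mem_monomialSpan_cons {i : Fin θ} {L : List (Fin θ)} {w : D.Bosonization} :
    w ∈ D.monomialSpan (i :: L) ↔ ∃ f : ℕ → D.monomialSpan L,
      w = ∑ n ∈ Finset.range (D.m i), D.x i ^ n * (f n : D.Bosonization) := Iff.rfl

theorem x_pow_mul_mem_monomialSpan (i : Fin θ) {L : List (Fin θ)} (n : ℕ) {w : D.Bosonization}
    (hw : w ∈ D.monomialSpan L) : D.x i ^ n * w ∈ D.monomialSpan (i :: L) := by
  by_cases hn : n < D.m i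
  · refine mem_monomialSpan_cons.2 ⟨Pi.single n ⟨w, hw⟩, ?_⟩
    rw [Finset.sum_eq_single n]
    · simp
    · intro l _ hl
      simp [hl]
    · simp [hn]
  · rw [pow_eq_zero_of_le (not_lt.1 hn) (D.x_pow_m i), zero_mul]
    exact Submodule.zero_mem _

theorem one_mem_monomialSpan (L : List (Fin θ)) : 1 ∈ D.monomialSpan L := by
  induction L with
  | nil => exact Submodule.subset_span rfl
  | cons i L ih => simpa using x_pow_mul_mem_monomialSpan i 0 ih

theorem exists_mul_pow_eq_smul {C : Type w} [Ring C] [Algebra k C] {y z : C}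
    (h : ∃ c : k, y * z = c • (z * y)) (n : ℕ) : ∃ c : k, y * z ^ n = c • (z ^ n * y) := by
  obtain ⟨c, hc⟩ := h
  induction n with
  | zero => exact ⟨1, by simp⟩
  | succ n ih =>
    obtain ⟨e, he⟩ := ih
    refine ⟨e * c, ?_⟩
    rw [pow_succ, ← mul_assoc, he, smul_mul_assoc, mul_assoc, hc, mul_smul_comm, smul_smul,
      mul_assoc]

theorem x_mul_mem_monomialSpan {j : Fin θ} {L : List (Fin θ)} (hj : j ∈ L) {w : D.Bosonization}
    (hw : w ∈ D.monomialSpan L) : D.x j * w ∈ D.monomialSpan L := by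
  induction L generalizing w with
  | nil => simp at hj
  | cons i L ih =>
    obtain ⟨f, rfl⟩ := mem_monomialSpan_cons.1 hw
    rw [Finset.mul_sum]
    refine Submodule.sum_mem _ fun n _ => ?_
    by_cases hij : j = i
    · rw [hij, ← mul_assoc, ← pow_succ']
      exact x_pow_mul_mem_monomialSpan i _ (f n).2
    · obtain ⟨c, hc⟩ := exists_mul_pow_eq_smul ⟨_, D.x_mul_x hij⟩ n
      rw [← mul_assoc, hc, smul_mul_assoc, mul_assoc]
      exact Submodule.smul_mem _ _ (x_pow_mul_mem_monomialSpan i _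
        (ih ((List.mem_cons.1 hj).resolve_left hij) (f n).2))

theorem grp_mul_monomialSpan (h : G) {L : List (Fin θ)} {w : D.Bosonization}
    (hw : w ∈ D.monomialSpan L) : ∃ w' ∈ D.monomialSpan L, D.grp h * w = w' * D.grp h := by
  induction L generalizing w with
  | nil =>
    obtain ⟨r, rfl⟩ := Submodule.mem_span_singleton.1 hw
    exact ⟨r • 1, hw, by simp⟩
  | cons i L ih =>
    obtain ⟨f, rfl⟩ := mem_monomialSpan_cons.1 hw
    choose f' hf' hff' using fun n => ih (f n).2
    choose c hc using exists_mul_pow_eq_smul (y := D.grp h) ⟨_, D.grp_mul_x h i⟩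
    refine ⟨∑ n ∈ Finset.range (D.m i), c n • (D.x i ^ n * f' n), Submodule.sum_mem _ fun n _ =>
      Submodule.smul_mem _ _ (x_pow_mul_mem_monomialSpan i _ (hf' n)), ?_⟩
    rw [Finset.mul_sum, Finset.sum_mul]
    refine Finset.sum_congr rfl fun n _ => ?_
    rw [← mul_assoc, hc, smul_mul_assoc, smul_mul_assoc, mul_assoc, mul_assoc, hff']

/-- The span of the products `w h` contains 1 and is stable under left multiplication by the
generators. Only this spanning half of the PBW theorem is needed. -/
theorem exists_sum_mul_grp [Fintype G] (y : D.Bosonization) :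
    ∃ f : G → D.Bosonization, (∀ h, f h ∈ D.monomialSpan (List.finRange θ)) ∧
      y = ∑ h, f h * D.grp h := by
  classical
  set R := D.monomialSpan (List.finRange θ)
  set Q : Submodule k D.Bosonization := Submodule.span k {y | ∃ w ∈ R, ∃ h, y = w * D.grp h}
  have hmul : ∀ y : D.Bosonization, ∀ z ∈ Q, y * z ∈ Q := by
    intro y
    induction y using D.induction with
    | hs r =>
      intro z hz
      rw [← Algebra.smul_def]
      exact Submodule.smul_mem _ _ hz
    | hg h =>
      intro z hz
      induction hz using Submodule.span_induction with
      | mem z hz =>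
        obtain ⟨w, hw, h', rfl⟩ := hz
        obtain ⟨w', hw', e⟩ := grp_mul_monomialSpan h hw
        exact Submodule.subset_span ⟨w', hw', h * h', by
          rw [← mul_assoc, e, mul_assoc, grp_mul]⟩
      | zero => simp
      | add a b _ _ ha hb => rw [mul_add]; exact Submodule.add_mem _ ha hb
      | smul r a _ ha => rw [mul_smul_comm]; exact Submodule.smul_mem _ _ ha
    | hx i =>
      intro z hz
      induction hz using Submodule.span_induction with
      | mem z hz =>
        obtain ⟨w, hw, h', rfl⟩ := hz
        exact Submodule.subset_span
          ⟨_, x_mul_mem_monomialSpan (List.mem_finRange i) hw, h', (mul_assoc _ _ _).symm⟩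
      | zero => simp
      | add a b _ _ ha hb => rw [mul_add]; exact Submodule.add_mem _ ha hb
      | smul r a _ ha => rw [mul_smul_comm]; exact Submodule.smul_mem _ _ ha
    | hm a b ha hb => intro z hz; rw [mul_assoc]; exact ha _ (hb _ hz)
    | ha a b ha hb =>
      intro z hz
      rw [add_mul]
      exact Submodule.add_mem _ (ha _ hz) (hb _ hz)
  have hy : y ∈ Q := by
    have h1 : (1 : D.Bosonization) ∈ Q :=
      Submodule.subset_span ⟨1, one_mem_monomialSpan _, 1, by rw [grp_one, one_mul]⟩
    simpa using hmul y 1 h1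
  clear hmul
  induction hy using Submodule.span_induction with
  | mem z hz =>
    obtain ⟨w, hw, h, rfl⟩ := hz
    refine ⟨Pi.single h w, fun h' => ?_, ?_⟩
    · by_cases hh : h' = h
      · subst hh; simpa using hw
      · simp [hh]
    · rw [Finset.sum_eq_single h]
      · simp
      · intro l _ hl
        simp [hl]
      · simp
  | zero => exact ⟨0, fun _ => Submodule.zero_mem _, by simp⟩
  | add a b _ _ ha hb =>
    obtain ⟨f, hf, rfl⟩ := ha
    obtain ⟨f', hf', rfl⟩ := hb
    exact ⟨f + f', fun h => Submodule.add_mem _ (hf h) (hf' h), by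
      simp [add_mul, Finset.sum_add_distrib]⟩
  | smul r a _ ha =>
    obtain ⟨f, hf, rfl⟩ := ha
    exact ⟨r • f, fun h => Submodule.smul_mem _ _ (hf h), by simp [Finset.smul_sum]⟩

end Spanning

end QLSDatum

/-- A subspace stable under operators with jointly distinct eigenvalues on a family of vectors
contains each member of the family as soon as it contains their sum. -/
theorem Submodule.mem_of_sum_mem_of_eigenvectors {k : Type*} [Field k] {V : Type*} [AddCommGroup V]
    [Module k V] {ι κ : Type*} (J : Submodule k V) (S : κ → Module.End k V) (μ : κ → ι → k)
    (hS : ∀ c, ∀ y ∈ J, S c y ∈ J) (hμ : ∀ i j, i ≠ j → ∃ c, μ c i ≠ μ c j) (s : Finset ι)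
    (y : ι → V) (hy : ∀ c i, S c (y i) = μ c i • y i) (hs : ∑ i ∈ s, y i ∈ J) :
    ∀ i ∈ s, y i ∈ J := by
  classical
  induction s using Finset.induction generalizing y with
  | empty => simp
  | insert j s hj ih =>
    have h1 : ∀ i ∈ s, y i ∈ J := by
      intro i hi
      obtain ⟨c, hc⟩ := hμ i j (fun h => hj (h ▸ hi))
      have h2 := ih (fun l => (μ c l - μ c j) • y l)
        (fun e l => by rw [map_smul, hy, smul_comm]) (by
          -- `S c - μ c j` removes the `j`-th summand and rescales the others, the `i`-th by a
          -- nonzero factor.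
          have h3 := J.sub_mem (hS c _ hs) (J.smul_mem (μ c j) hs)
          rw [Finset.sum_insert hj, map_add, map_sum, hy, smul_add, add_sub_add_left_eq_sub,
            Finset.smul_sum, ← Finset.sum_sub_distrib] at h3
          simpa only [hy, sub_smul] using h3) i hi
      exact (J.smul_mem_iff (sub_ne_zero.2 hc)).1 h2
    intro i hi
    rcases Finset.mem_insert.1 hi with rfl | hi
    · rw [Finset.sum_insert hj] at hs
      exact (J.add_mem_iff_left (J.sum_mem h1)).1 hs
    · exact h1 i hi

namespace QLSDatum

variable {k : Type u} [Field k] {G : Type v} [CommGroup G] {θ : ℕ} {D : QLSDatum k G θ}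

/-- A Hopf ideal of the bosonization is zero if it is stable under enough translates: under
automorphisms that fix the `x i` and separate the group elements, and under skew derivations
that separate the `x i` from each other. -/
theorem eq_bot_of_stable [Finite G] {I : Ideal D.Bosonization} (hI2 : I.IsTwoSided)
    (hI : I.IsHopfIdeal k) {κ : Type w} [DecidableEq κ] (β : κ → G →* kˣ) (a : Fin θ → κ) (b : κ)
    (S : κ → Module.End k D.Bosonization) (T : Fin θ → Module.End k D.Bosonization)
    (hSI : ∀ c, ∀ y ∈ I, S c y ∈ I) (hTI : ∀ i, ∀ y ∈ I, T i y ∈ I)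
    (hS1 : ∀ c, S c 1 = 1) (hS : ∀ c y z, S c (y * z) = S c y * S c z)
    (hSg : ∀ c h, S c (D.grp h) = (β c h : k) • D.grp h) (hSx : ∀ c i, S c (D.x i) = D.x i)
    (hT : ∀ i y z, T i (y * z) = T i y * S (a i) z + S b y * T i z)
    (hTx : ∀ i j, T i (D.x j) = if a j = a i then D.grp (D.g j) else 0)
    (hβ : ∀ h h' : G, h ≠ h' → ∃ c, β c h ≠ β c h')
    (hpair : ∀ i, ∃ μ : k, (β (a i) (D.g i) : k) ≠ μ ∧
      ∀ j, j ≠ i → a j = a i → (β (a i) (D.g j) : k) = μ) : I = ⊥ := by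
  have hT1 : ∀ i, T i 1 = 0 := by
    intro i
    simpa [hS1] using hT i 1 1
  have hSxp : ∀ c i n, S c (D.x i ^ n) = D.x i ^ n := by
    intro c i n
    induction n with
    | zero => simp [hS1]
    | succ n ih => rw [pow_succ, hS, ih, hSx]
  have hSR : ∀ L, ∀ w ∈ D.monomialSpan L, ∀ c, S c w = w := by
    intro L
    induction L with
    | nil =>
      intro w hw c
      obtain ⟨r, rfl⟩ := Submodule.mem_span_singleton.1 hw
      rw [map_smul, hS1]
    | cons i L ih =>
      intro w hw c
      obtain ⟨f, rfl⟩ := mem_monomialSpan_cons.1 hw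
      rw [map_sum]
      exact Finset.sum_congr rfl fun n _ => by rw [hS, hSxp, ih _ (f n).2]
  -- `T i` acts on powers of `x_i` as a `q`-derivative; the `q`-integer is nonzero below the order
  -- `m_i`.
  have hTxp : ∀ i n, T i (D.x i ^ (n + 1)) =
      (∑ s ∈ Finset.range (n + 1), (D.χ i (D.g i) : k) ^ s) • (D.x i ^ n * D.grp (D.g i)) := by
    intro i n
    induction n with
    | zero => simp [hTx]
    | succ n ih =>
      rw [pow_succ, hT, ih, hSx, hSxp, hTx, if_pos rfl, smul_mul_assoc, mul_assoc, grp_mul_x,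
        mul_smul_comm, smul_smul, ← mul_assoc, ← pow_succ]
      conv_lhs => rw [← one_smul k (D.x i ^ (n + 1) * D.grp (D.g i))]
      rw [smul_smul, mul_one, ← add_smul, geom_sum_succ (n := n + 1), mul_comm]
  have hgeom : ∀ i n, n + 1 < D.m i →
      (∑ s ∈ Finset.range (n + 1), (D.χ i (D.g i) : k) ^ s) ≠ 0 := by
    intro i n hn h0
    have h1 := geom_sum_mul (D.χ i (D.g i) : k) (n + 1)
    rw [h0, zero_mul, eq_comm, sub_eq_zero, ← Units.val_pow_eq_pow_val, Units.val_eq_one] at h1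
    exact pow_ne_one_of_lt_orderOf (Nat.succ_ne_zero n) hn h1
  -- On monomials without `x_i`, each term of `T i` replaces one `x_j` of the same source by `g_j`,
  -- so the result is a `μ`-eigenvector of `S (a i)`. This distinguishes it from a derivative in
  -- `x_i`, whose eigenvalue is not `μ`.
  have hTR : ∀ i (μ : k), (∀ j, j ≠ i → a j = a i → (β (a i) (D.g j) : k) = μ) →
      ∀ L, i ∉ L → ∀ w ∈ D.monomialSpan L, S (a i) (T i w) = μ • T i w := by
    intro i μ hμ L
    induction L with
    | nil =>
      intro _ w hw
      obtain ⟨r, rfl⟩ := Submodule.mem_span_singleton.1 hw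
      simp [hT1]
    | cons j L ih =>
      intro hL w hw
      obtain ⟨hij, hL⟩ := not_or.1 (mt List.mem_cons.2 hL)
      have hpow : ∀ n, S (a i) (T i (D.x j ^ n)) = μ • T i (D.x j ^ n) := by
        intro n
        induction n with
        | zero => simp [hT1]
        | succ n ihn =>
          have hj : S (a i) (T i (D.x j)) = μ • T i (D.x j) := by
            rw [hTx]
            split_ifs with h
            · rw [hSg, hμ j (Ne.symm hij) h]
            · simp
          rw [pow_succ, hT, map_add, hS, hS, hSx, hSx, hSxp, hSxp, ihn, hj, smul_add,
            smul_mul_assoc, mul_smul_comm]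
      obtain ⟨f, rfl⟩ := mem_monomialSpan_cons.1 hw
      rw [map_sum, map_sum, Finset.smul_sum]
      refine Finset.sum_congr rfl fun n _ => ?_
      rw [hT, map_add, hS, hS, hSxp, hSxp, hSR _ _ (f n).2, hSR _ _ (f n).2, hpow,
        ih hL _ (f n).2, smul_add, smul_mul_assoc, mul_smul_comm]
  have hR : ∀ L : List (Fin θ), L.Nodup → ∀ w ∈ D.monomialSpan L, w ∈ I → w = 0 := by
    intro L
    induction L with
    | nil =>
      intro _ w hw hwI
      obtain ⟨r, rfl⟩ := Submodule.mem_span_singleton.1 hw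
      have h0 : D.counitHom (r • 1) = 0 := hI.counit_eq_zero hwI
      rw [map_smul, map_one, smul_eq_mul, mul_one] at h0
      rw [h0, zero_smul]
    | cons i L ih =>
      intro hL
      obtain ⟨hiL, hL⟩ := List.nodup_cons.1 hL
      obtain ⟨μ, hμ, hμ'⟩ := hpair i
      -- Induction on the degree in `x_i`. Applying `T i` gives `g_i Z + Y`, where `Z` has lower
      -- degree in `x_i` and `Y` comes from differentiating the coefficients. `S (a i)` separates
      -- the two summands, so `Z` lies in the ideal.
      have key : ∀ N ≤ D.m i, ∀ f : ℕ → D.Bosonization, (∀ n, f n ∈ D.monomialSpan L) →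
          ∑ n ∈ Finset.range N, D.x i ^ n * f n ∈ I → ∀ n < N, f n = 0 := by
        intro N
        induction N with
        | zero => intro _ _ _ _ n hn; omega
        | succ N ihN =>
          intro hN f hf hfI
          -- The `q`-integer from `T i`, times the scalar from moving `g_i` to the left of `x_i^n`.
          set c : ℕ → k := fun n => (∑ s ∈ Finset.range (n + 1), (D.χ i (D.g i) : k) ^ s) *
            (D.χ i (D.g i)⁻¹ : k) ^ n with hc
          have hterm : ∀ n, T i (D.x i ^ (n + 1)) * f (n + 1) =
              D.grp (D.g i) * (D.x i ^ n * (c n • f (n + 1))) := by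
            intro n
            rw [hTxp, qCommute_pow (D.x_mul_grp (D.g i) i) n, smul_smul, smul_mul_assoc,
              mul_smul_comm, mul_smul_comm, mul_assoc]
          set Z := ∑ n ∈ Finset.range N, D.x i ^ n * (c n • f (n + 1)) with hZ
          set Y := ∑ n ∈ Finset.range (N + 1), D.x i ^ n * T i (f n) with hY
          have hTf : T i (∑ n ∈ Finset.range (N + 1), D.x i ^ n * f n) =
              D.grp (D.g i) * Z + Y := by
            simp only [map_sum, hT, hSxp, hSR _ _ (hf _), Finset.sum_add_distrib]
            congr 1
            rw [Finset.sum_range_succ', pow_zero, hT1, zero_mul, add_zero, hZ, Finset.mul_sum]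
            exact Finset.sum_congr rfl fun n _ => hterm n
          have hSZ : S (a i) (D.grp (D.g i) * Z) =
              (β (a i) (D.g i) : k) • (D.grp (D.g i) * Z) := by
            rw [hS, hSg, smul_mul_assoc]
            congr 2
            rw [map_sum]
            exact Finset.sum_congr rfl fun n _ => by rw [hS, hSxp, map_smul, hSR _ _ (hf _)]
          have hSY : S (a i) Y = μ • Y := by
            rw [map_sum, Finset.smul_sum]
            exact Finset.sum_congr rfl fun n _ => by
              rw [hS, hSxp, hTR i μ hμ' L hiL _ (hf n), mul_smul_comm]
          have hZY : D.grp (D.g i) * Z + Y ∈ I := hTf ▸ hTI i _ hfI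
          have hgZ : D.grp (D.g i) * Z ∈ I := by
            have h1 : ((β (a i) (D.g i) : k) - μ) • (D.grp (D.g i) * Z) ∈ I.restrictScalars k := by
              have h2 := (I.restrictScalars k).sub_mem (hSI (a i) _ hZY)
                ((I.restrictScalars k).smul_mem μ hZY)
              rwa [map_add, hSZ, hSY, smul_add, add_sub_add_right_eq_sub, ← sub_smul] at h2
            exact ((I.restrictScalars k).smul_mem_iff (sub_ne_zero.2 hμ)).1 h1
          have hZI : Z ∈ I := by
            have := I.mul_mem_left (D.grp (D.g i)⁻¹) hgZ
            rwa [← mul_assoc, grp_inv_mul, one_mul] at this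
          have hf0 : ∀ n < N, f (n + 1) = 0 := by
            intro n hn
            have h1 := ihN (by omega) (fun n => c n • f (n + 1))
              (fun n => Submodule.smul_mem _ _ (hf _)) hZI n hn
            refine (smul_eq_zero.1 h1).resolve_left (mul_ne_zero (hgeom i n (by omega)) ?_)
            exact pow_ne_zero _ (Units.ne_zero _)
          have hf00 : f 0 = 0 := by
            refine ih hL _ (hf 0) ?_
            rw [Finset.sum_range_succ', Finset.sum_eq_zero, zero_add, pow_zero, one_mul] at hfI
            · exact hfI
            · intro n hn
              rw [hf0 n (Finset.mem_range.1 hn), mul_zero]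
          intro n hn
          cases n with
          | zero => exact hf00
          | succ n => exact hf0 n (by omega)
      intro w hw hwI
      obtain ⟨f, rfl⟩ := mem_monomialSpan_cons.1 hw
      have h0 := key _ le_rfl (fun n => f n) (fun n => (f n).2) hwI
      exact Finset.sum_eq_zero fun n hn => by
        rw [show (f n : D.Bosonization) = 0 from h0 n (Finset.mem_range.1 hn), mul_zero]
  have := Fintype.ofFinite G
  rw [eq_bot_iff]
  intro y hy
  obtain ⟨f, hf, rfl⟩ := exists_sum_mul_grp y
  -- The `S c` fix ordered monomials and scale group elements by jointly separating characters, so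
  -- each `f h * D.grp h` lies in the ideal.
  have h1 := Submodule.mem_of_sum_mem_of_eigenvectors (I.restrictScalars k) S
    (fun c h => (β c h : k)) hSI
    (fun h h' hh => (hβ h h' hh).imp fun c hc h0 => hc (Units.ext h0)) Finset.univ
    (fun h => f h * D.grp h)
    (fun c h => by rw [hS, hSg, hSR _ _ (hf h), mul_smul_comm]) hy
  refine (Submodule.mem_bot _).2 (Finset.sum_eq_zero fun h hh => ?_)
  have h2 : f h ∈ I := by
    have := I.mul_mem_right (D.grp h⁻¹) (h1 h hh)
    rwa [mul_assoc, grp_mul_inv, mul_one] at this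
  rw [hR _ (List.nodup_finRange θ) _ (hf h) h2, zero_mul]

end QLSDatum

/-! ### Inner faithfulness of the shift action. -/

section InnerFaithful

variable {k : Type u} [Field k] {G : Type v} [CommGroup G] {θ : ℕ} (D : QLSDatum k G θ)
  {t : ℕ} {p : Fin t → Fin t → kˣ} (β : Fin t → G →* kˣ) (hp : IsMultAntisymm p)
  {b : Fin t} {src : Fin θ → Fin t} (hsrc : ∀ i, src i ≠ b)
  (hχ : ∀ i h, D.χ i h = β b h / β (src i) h)
  (hβ : ∀ i c, c ≠ src i → (β c (D.g i) : k) = p c (src i) * p b c)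

/-- The matrix coefficient of the action at the generators `u_c` and `u_d`. -/
noncomputable def matrixCoeff (ρ : D.Bosonization →ₐ[k] Module.End k (QuantumAffineSpace p))
    (c d : Fin t) : D.Bosonization →ₗ[k] k :=
  coeff p d ∘ₗ LinearMap.applyₗ (gen p c) ∘ₗ ρ.toLinearMap

theorem matrixCoeff_apply (ρ : D.Bosonization →ₐ[k] Module.End k (QuantumAffineSpace p))
    (c d : Fin t) (y : D.Bosonization) : matrixCoeff D ρ c d y = coeff p d (ρ y (gen p c)) := rfl

theorem shiftAction_gen_target (y : D.Bosonization) :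
    shiftAction D β hp hsrc hχ hβ y (gen p b) =
      matrixCoeff D (shiftAction D β hp hsrc hχ hβ) b b y • gen p b := by
  have h : ∃ r : k, shiftAction D β hp hsrc hχ hβ y (gen p b) = r • gen p b := by
    induction y using D.induction with
    | hs r => exact ⟨r, by simp⟩
    | hg h => exact ⟨β b h, by simp⟩
    | hx i => exact ⟨0, by simp [shift_gen, (hsrc i).symm]⟩
    | hm y z hy hz =>
      obtain ⟨r, hr⟩ := hy
      obtain ⟨s, hs⟩ := hz
      exact ⟨s * r, by rw [map_mul, Module.End.mul_apply, hs, map_smul, hr, smul_smul]⟩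
    | ha y z hy hz =>
      obtain ⟨r, hr⟩ := hy
      obtain ⟨s, hs⟩ := hz
      exact ⟨r + s, by rw [map_add, LinearMap.add_apply, hs, hr, add_smul]⟩
  obtain ⟨r, hr⟩ := h
  rw [matrixCoeff_apply, hr, map_smul, coeff_gen_self, smul_eq_mul, mul_one]

/-- The action is triangular on the span of `u_c` and `u_b`. Its diagonal coefficients are therefore
multiplicative and the off-diagonal one obeys a skew Leibniz rule. -/
theorem shiftAction_gen {c : Fin t} (hc : c ≠ b) (y : D.Bosonization) :
    shiftAction D β hp hsrc hχ hβ y (gen p c) =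
      matrixCoeff D (shiftAction D β hp hsrc hχ hβ) c c y • gen p c +
        matrixCoeff D (shiftAction D β hp hsrc hχ hβ) c b y • gen p b := by
  have h : ∃ r s : k,
      shiftAction D β hp hsrc hχ hβ y (gen p c) = r • gen p c + s • gen p b := by
    induction y using D.induction with
    | hs r => exact ⟨r, 0, by simp⟩
    | hg h => exact ⟨β c h, 0, by simp⟩
    | hx i => exact ⟨0, if c = src i then 1 else 0, by simp [shift_gen]⟩
    | hm y z hy hz =>
      obtain ⟨r, s, hr⟩ := hy
      obtain ⟨r', s', hr'⟩ := hz
      have hb := shiftAction_gen_target D β hp hsrc hχ hβ y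
      exact ⟨r' * r, r' * s + s' * _, by
        rw [map_mul, Module.End.mul_apply, hr', map_add, map_smul, map_smul, hr, hb, smul_add,
          smul_smul, smul_smul, smul_smul, add_smul, add_assoc]⟩
    | ha y z hy hz =>
      obtain ⟨r, s, hr⟩ := hy
      obtain ⟨r', s', hr'⟩ := hz
      exact ⟨r + r', s + s', by
        rw [map_add, LinearMap.add_apply, hr, hr', add_smul, add_smul, add_add_add_comm]⟩
  obtain ⟨r, s, hr⟩ := h
  rw [matrixCoeff_apply, matrixCoeff_apply, hr]
  simp [coeff_gen, hc, hc.symm]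

theorem matrixCoeff_self_mul (c : Fin t) (y z : D.Bosonization) :
    matrixCoeff D (shiftAction D β hp hsrc hχ hβ) c c (y * z) =
      matrixCoeff D (shiftAction D β hp hsrc hχ hβ) c c y *
        matrixCoeff D (shiftAction D β hp hsrc hχ hβ) c c z := by
  rw [matrixCoeff_apply, map_mul, Module.End.mul_apply]
  by_cases hc : c = b
  · subst hc
    rw [shiftAction_gen_target _ _ _ _ _ _ z, map_smul, map_smul, smul_eq_mul, mul_comm]
    rfl
  · rw [shiftAction_gen _ _ _ _ _ _ hc z, map_add, map_smul, map_smul,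
      shiftAction_gen_target _ _ _ _ _ _ y, map_add, map_smul, map_smul, map_smul, coeff_gen,
      if_neg (Ne.symm hc), smul_zero, smul_zero, add_zero, smul_eq_mul, mul_comm]
    rfl

theorem matrixCoeff_mul {c : Fin t} (hc : c ≠ b) (y z : D.Bosonization) :
    matrixCoeff D (shiftAction D β hp hsrc hχ hβ) c b (y * z) =
      matrixCoeff D (shiftAction D β hp hsrc hχ hβ) c b y *
          matrixCoeff D (shiftAction D β hp hsrc hχ hβ) c c z +
        matrixCoeff D (shiftAction D β hp hsrc hχ hβ) b b y *
          matrixCoeff D (shiftAction D β hp hsrc hχ hβ) c b z := by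
  rw [matrixCoeff_apply, map_mul, Module.End.mul_apply, shiftAction_gen _ _ _ _ _ _ hc z, map_add,
    map_smul, map_smul, map_add, map_smul, map_smul, smul_eq_mul, smul_eq_mul, mul_comm,
    mul_comm (matrixCoeff D _ c b z)]
  rfl

/-- Matrix coefficients vanish on an annihilating Hopf ideal, so their translates preserve it. The
diagonal ones supply the operators `S`, those from a source to `u_b` the operators `T` of
`eq_bot_of_stable`. -/
theorem isInnerFaithful_shiftAction [Finite G]
    (hsep : ∀ h h' : G, h ≠ h' → ∃ c, β c h ≠ β c h')
    (hpair : ∀ i, ∃ μ : k, (β (src i) (D.g i) : k) ≠ μ ∧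
      ∀ j, j ≠ i → src j = src i → (β (src i) (D.g j) : k) = μ) :
    IsInnerFaithful (shiftAction D β hp hsrc hχ hβ) := by
  intro I hI2 hI hann
  set ρ := shiftAction D β hp hsrc hχ hβ with hρ
  have hI0 : ∀ c d, ∀ y ∈ I, matrixCoeff D ρ c d y = 0 := by
    intro c d y hy
    rw [matrixCoeff_apply, hann y hy, map_zero]
  have hone : ∀ c d, matrixCoeff D ρ c d 1 = if c = d then 1 else 0 := by
    intro c d
    simp [matrixCoeff_apply, coeff_gen]
  have hgrp : ∀ c d h, matrixCoeff D ρ c d (D.grp h) = if c = d then (β c h : k) else 0 := by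
    intro c d h
    simp [matrixCoeff_apply, coeff_gen, hρ]
  have hx : ∀ c d i, matrixCoeff D ρ c d (D.x i) = if c = src i ∧ b = d then 1 else 0 := by
    intro c d i
    by_cases h1 : c = src i <;> by_cases h2 : b = d <;>
      simp [matrixCoeff_apply, hρ, shift_gen, coeff_gen, h1, h2]
  refine D.eq_bot_of_stable hI2 hI β src b (fun c => D.translate (matrixCoeff D ρ c c))
    (fun i => D.translate (matrixCoeff D ρ (src i) b))
    (fun c y hy => D.translate_mem hI (hI0 c c) hy)
    (fun i y hy => D.translate_mem hI (hI0 (src i) b) hy) ?_ ?_ ?_ ?_ ?_ ?_ hsep hpair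
  · intro c
    rw [← D.grp_one, D.translate_grp, D.grp_one, hone, if_pos rfl, one_smul]
  · intro c y z
    have h := D.translate_mul (φ := matrixCoeff D ρ c c) (φ₁ := matrixCoeff D ρ c c)
      (φ₂ := matrixCoeff D ρ c c) (φ₃ := 0) (φ₄ := 0) (fun y z => by
        rw [hρ, matrixCoeff_self_mul, LinearMap.zero_apply, zero_mul, add_zero]) y z
    rw [h]
    simp [QLSDatum.translate]
  · intro c h
    rw [D.translate_grp, hgrp, if_pos rfl]
  · intro c i
    have hne : ¬ (c = src i ∧ b = c) := fun h => hsrc i (h.1.symm.trans h.2.symm)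
    rw [D.translate_x, hone, hx, if_pos rfl, if_neg hne, one_smul, zero_smul, add_zero]
  · intro i y z
    exact D.translate_mul (matrixCoeff_mul D β hp hsrc hχ hβ (hsrc i)) y z
  · intro i j
    rw [D.translate_x, hone, hx, if_neg (hsrc i), zero_smul, zero_add]
    by_cases h : src j = src i
    · rw [if_pos ⟨h.symm, rfl⟩, if_pos h, one_smul]
    · rw [if_neg (fun h' => h h'.1.symm), if_neg h, zero_smul]

end InnerFaithful

/-! ### The example of rank `2(t - 1)` and the main theorem. -/

section Sharpness

variable {k : Type u} [Field k]

/-- Finitely many diagonal matrices of finite order lie in a finite group of diagonal matrices. -/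
theorem exists_finite_group_of_pow_eq_one {t : ℕ} {ι : Type*} (N : ℕ) [NeZero N]
    (α : ι → Fin t → kˣ) (hα : ∀ i c, α i c ^ N = 1) :
    ∃ (G : Type) (_ : CommGroup G) (_ : Finite G) (β : Fin t → G →* kˣ) (g : ι → G),
      (∀ h h' : G, h ≠ h' → ∃ c, β c h ≠ β c h') ∧ ∀ i c, β c (g i) = α i c := by
  -- The group of diagonal matrices lives in the universe of `k`; being finite, it has a copy in
  -- `Type`.
  let e : Shrink.{0} (Fin t → rootsOfUnity N k) ≃* (Fin t → rootsOfUnity N k) := Shrink.mulEquiv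
  have : Finite (Shrink.{0} (Fin t → rootsOfUnity N k)) := Finite.of_equiv _ e.toEquiv.symm
  refine ⟨Shrink.{0} (Fin t → rootsOfUnity N k), inferInstance, this,
    fun c => ((rootsOfUnity N k).subtype.comp (Pi.evalMonoidHom _ c)).comp e.toMonoidHom,
    fun i => e.symm fun c => ⟨α i c, (mem_rootsOfUnity N _).2 (hα i c)⟩, ?_, ?_⟩
  · intro h h' hne
    by_contra! hc
    exact hne (e.injective (funext fun c => Subtype.ext (hc c)))
  · intro i c
    simp

theorem exists_shiftAction {s : ℕ} {p : Fin (s + 1) → Fin (s + 1) → kˣ} (hp : IsMultAntisymm p)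
    (hfin : ∀ i j, orderOf (p i j) ≠ 0) {ζ : kˣ} (hζ : orderOf ζ = 3) :
    ∃ (G : Type) (_ : CommGroup G) (_ : Finite G) (D : QLSDatum k G (2 * s))
      (ρ : D.Bosonization →ₐ[k] Module.End k (QuantumAffineSpace p)),
      (∀ i, 3 ≤ D.m i) ∧ IsHopfAction ρ ∧ IsLinearAction D p ρ ∧ IsInnerFaithful ρ := by
  -- A common exponent for `ζ` and all `p_ij`, hence for every eigenvalue used below.
  let N : ℕ := 3 * ∏ i, ∏ j, orderOf (p i j)
  have hN : N ≠ 0 := mul_ne_zero (by norm_num)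
    (Finset.prod_ne_zero_iff.2 fun i _ => Finset.prod_ne_zero_iff.2 fun j _ => hfin i j)
  have : NeZero N := ⟨hN⟩
  have hpN : ∀ i j, p i j ^ N = 1 := fun i j => orderOf_dvd_iff_pow_eq_one.1 <|
    ((Finset.dvd_prod_of_mem (fun j => orderOf (p i j)) (Finset.mem_univ j)).trans
      (Finset.dvd_prod_of_mem (fun i => ∏ j, orderOf (p i j)) (Finset.mem_univ i))).trans
      (Dvd.intro_left 3 rfl)
  let e : Fin (2 * s) ≃ Fin 2 × Fin s := finProdFinEquiv.symm
  let src : Fin (2 * s) → Fin (s + 1) := fun i => (e i).2.succ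
  let q : Fin (2 * s) → kˣ := fun i => if (e i).1 = 0 then ζ else ζ⁻¹
  have hsrc : ∀ i, src i ≠ 0 := fun i => Fin.succ_ne_zero _
  have hq3 : ∀ i, orderOf (q i) = 3 := by
    intro i
    by_cases h : (e i).1 = 0 <;> simp [q, h, hζ]
  have hqN : ∀ i, q i ^ N = 1 := fun i =>
    orderOf_dvd_iff_pow_eq_one.1 (by rw [hq3]; exact Dvd.intro _ rfl)
  have hqq : ∀ i j, i ≠ j → src i = src j → q i * q j = 1 := by
    intro i j hij hs
    have h2 : (e i).2 = (e j).2 := Fin.succ_injective _ hs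
    have h1 : (e i).1 ≠ (e j).1 := fun h => hij (e.injective (Prod.ext h h2))
    by_cases hi : (e i).1 = 0
    · simp [q, hi, (hi ▸ h1).symm]
    · have hj : (e j).1 = 0 := by omega
      simp [q, hi, hj]
  obtain ⟨G, hG, hGf, β, g, hsep, hg⟩ := exists_finite_group_of_pow_eq_one N
    -- These are the eigenvalues forced by `skewDerivation_diagonal` for a shift from `src i` to 0
    -- with parameter `q i`.
    (fun i c => p c (src i) * p 0 c * if c = src i then (q i)⁻¹ else 1) (by
      intro i c
      rw [mul_pow, mul_pow, hpN, hpN, one_mul, one_mul]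
      split_ifs
      · rw [inv_pow, hqN, inv_one]
      · exact one_pow N)
  have hg0 : ∀ i, β 0 (g i) = p 0 (src i) := by
    intro i
    rw [hg, if_neg (hsrc i).symm, hp.1, mul_one, mul_one]
  have hgs : ∀ i, β (src i) (g i) = p 0 (src i) * (q i)⁻¹ := by
    intro i
    rw [hg, if_pos rfl, hp.1, one_mul]
  have hself : ∀ i j, src i = src j → (β 0 / β (src i)) (g j) = q j := by
    intro i j hij
    rw [MonoidHom.div_apply, hij, hg0, hgs, div_mul_eq_div_div, div_self', one_div, inv_inv]
  let D : QLSDatum k G (2 * s) :=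
    { g := g
      χ := fun i => β 0 / β (src i)
      compat := by
        intro i j hij
        by_cases hs : src i = src j
        · rw [hself i j hs, hself j i hs.symm, eq_inv_iff_mul_eq_one, mul_comm]
          exact hqq i j hij hs
        -- For different sources, compatibility is the antisymmetry of `p` at the two sources.
        · rw [MonoidHom.div_apply, MonoidHom.div_apply, hg0, hg0, hg, hg, if_neg hs,
            if_neg (Ne.symm hs), hp.2 (src i) (src j), mul_one, mul_one, inv_div,
            div_eq_div_iff_mul_eq_mul]
          rw [mul_mul_mul_comm, mul_comm (p 0 (src j)), mul_assoc, mul_comm (p 0 (src i))]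
          group
      two_le_order := fun i => by rw [hself i i rfl, hq3]; norm_num }
  have hχ : ∀ i h, D.χ i h = β 0 h / β (src i) h := fun i h => rfl
  have hβ : ∀ i c, c ≠ src i → (β c (D.g i) : k) = p c (src i) * p 0 c := by
    intro i c hc
    change (β c (g i) : k) = _
    rw [hg, if_neg hc, mul_one, Units.val_mul]
  refine ⟨G, hG, hGf, D, shiftAction D β hp hsrc hχ hβ, fun i => ?_,
    isHopfAction_shiftAction D β hp hsrc hχ hβ, isLinearAction_shiftAction D β hp hsrc hχ hβ,
    isInnerFaithful_shiftAction D β hp hsrc hχ hβ hsep fun i => ?_⟩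
  · change 3 ≤ orderOf ((β 0 / β (src i)) (g i))
    rw [hself i i rfl, hq3]
  -- The other index with this source has parameter `(q i)⁻¹`, hence eigenvalue `p_{0,src i} q_i`.
  -- It differs from `p_{0,src i} q_i⁻¹` because `q_i² ≠ 1`.
  · refine ⟨(p 0 (src i) * q i : kˣ), ?_, ?_⟩
    · change (β (src i) (g i) : k) ≠ _
      rw [hgs, Ne, Units.val_inj, mul_right_inj, inv_eq_iff_mul_eq_one, ← pow_two]
      exact pow_ne_one_of_lt_orderOf two_ne_zero (by rw [hq3]; norm_num)
    · intro j hji hs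
      change (β (src i) (g j) : k) = _
      rw [← hs, hgs, Units.val_inj, inv_eq_of_mul_eq_one_right (hqq j i hji hs)]

end Sharpness

theorem mainTheorem1 {k : Type u} [Field k] [IsAlgClosed k] [CharZero k]
    {t : ℕ} (ht : 2 ≤ t) (p : Fin t → Fin t → kˣ) (hp : IsMultAntisymm p)
    (hord : ∀ i j, i ≠ j → orderOf (p i j) = 0 ∨ 3 ≤ orderOf (p i j)) :
    (∀ (G : Type v) [CommGroup G] [Finite G] (θ : ℕ) (D : QLSDatum k G θ)
        (ρ : D.Bosonization →ₐ[k] Module.End k (QuantumAffineSpace p)),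
        (∀ i, 3 ≤ D.m i) → IsHopfAction ρ → IsLinearAction D p ρ → IsInnerFaithful ρ →
        θ ≤ 2 * (t - 1)) ∧
    ((∀ i j, orderOf (p i j) ≠ 0) →
      ∃ (G : Type) (_ : CommGroup G) (_ : Finite G) (D : QLSDatum k G (2 * (t - 1)))
        (ρ : D.Bosonization →ₐ[k] Module.End k (QuantumAffineSpace p)),
        (∀ i, 3 ≤ D.m i) ∧ IsHopfAction ρ ∧ IsLinearAction D p ρ ∧ IsInnerFaithful ρ) := by
  constructor
  · intro G _ _ θ D ρ hm hρ hlin hf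
    refine IsLinearAction.rank_le hp (by omega) (fun a b hab h => ?_) hm hρ hlin hf
    rw [← Units.val_mul, Units.val_eq_one, ← pow_two] at h
    have h1 := orderOf_dvd_of_pow_eq_one h
    have h2 := Nat.le_of_dvd two_pos h1
    rcases hord a b hab with h3 | h3
    -- `orderOf` equal to 0 encodes infinite order, and 0 does not divide 2.
    · rw [h3] at h1
      omega
    · omega
  · intro hfin
    obtain ⟨s, rfl⟩ : ∃ s, t = s + 1 := ⟨t - 1, by omega⟩
    obtain ⟨ζ, hζ⟩ := HasEnoughRootsOfUnity.exists_primitiveRoot k 3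
    obtain ⟨ζ, rfl⟩ := hζ.isUnit three_ne_zero
    exact exists_shiftAction hp hfin
      (by rw [← orderOf_units, ← hζ.eq_orderOf])
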